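/- **Setting.** Let $\tilde X$ be a locally compact metric space with an isometric, properly discontinuous action of a discrete group $G$ such that $X=\tilde X/G$ is compact and $p:\tilde X\to X$ is the quotient covering map (so the action is free). Give $X$ the quotient metric. Let $\tilde r:\tilde X\to\tilde X$ be a homeomorphism with $d(x,y)\le\theta\, d(\tilde r x,\tilde r y)$ for all $x,y$ and some $0<\theta<1$, and let $A\in\mathrm{End}(G)$ be such that $AG$ is normal in $G$ and $\tilde r(gx)=(Ag)\,\tilde r x$ for all $g\in G$, $x\in\tilde X$. Let $r:X\to X$, $r(px)=p(\tilde r x)$. Let $g_1,\dots,g_q$ be a complete system of representatives of the right cosets of $AG$ in $G$, and put $\psi_i(x)=\tilde r^{-1}(g_i x)$. Let $\xi$ be a complex vector bundle over $X$ of rank $d$ with a Hermitian inner product on its fibres, which is Lipschitz: there are local trivializations $\varphi_i:\xi|_{U_i}\to U_i\times\mathbb C^d$ whose domains cover $X$ and whose matrix-valued transition functions are Lipschitz on $U_i\cap U_j$. Assume that $p^*\xi$ is identified with the trivial Hermitian bundle $\tilde X\times\mathbb C^d$ by linear isometries $u_x:\mathbb C^d\to\xi_{p(x)}$ such that, for each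 $i$, the matrix function $x\mapsto\varphi_i(p(x))u_x$ is Lipschitz on $p^{-1}(U_i)$. Let $\mathrm{End}(\xi)$ be the algebra of continuous bundle maps $\xi\to\xi$, with the norm $\|h\|_\infty=\sup_{y\in X}\|h(y)\|$; an $n\times n$ matrix over $\mathrm{End}(\xi)$ is positive if at each $y\in X$ it is a positive operator on $\xi_y^{\,n}$, and a linear map $T$ of $\mathrm{End}(\xi)$ into itself is completely positive if for every $n$ its entrywise application to $n\times n$ matrices preserves positivity. For a section $s$ of $\xi$ put $(p^*s)(x)=u_x^{-1}s(p(x))$. Let $S_1$ be the space of continuous sections $s$ for which $p^*s$ is Lipschitz, with the norm $$\|s\|_1=\sup_{y\in X}\|s(y)\|+\sup_{x\ne y\in\tilde X}\frac{\|p^*s(x)-p^*s(y)\|}{d(x,y)} .$$ Let $L\subset\mathrm{End}(\xi)$ be the algebra of those $h$ for which $s\mapsto hs$ is a bounded operator $S_1\to S_1$, with the operator norm $\|h\|_1$ on $(S_1,\|\cdot\|_1)$. Let $m:r^*\xi\to\xi$ be a bundle map, with fibre maps $m(z):\xi_{r(z)}\to\xi_z$, that is Lipschitz, i.e. the matrix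 function $x\mapsto u_x^{-1}m(p(x))u_{\tilde r x}$ is Lipschitz on $\tilde X$. For $h\in\mathrm{End}(\xi)$ let $$(Rh)(px)=\sum_{i=1}^q m^*(p\psi_i x)\,h(p\psi_i x)\,m(p\psi_i x)\qquad(x\in\tilde X),$$ which depends only on $p(x)$, and assume that $\sup_k\|R^k\|_\infty<\infty$, where $\|R^k\|_\infty$ is the operator norm of $R^k$ on $(\mathrm{End}(\xi),\|\cdot\|_\infty)$. **Theorem.** There is a linear map $T_1:\mathrm{End}(\xi)\to\mathrm{End}(\xi)$ such that for every $g\in\mathrm{End}(\xi)$ the Cesàro means $k^{-1}\sum_{j=1}^kR^jg$ converge to $T_1g$ in $\|\cdot\|_\infty$ as $k\to\infty$. The map $T_1$ is completely positive and idempotent; it maps $L$ into $L$, and $T_1|_L$ is bounded for $\|\cdot\|_1$. Moreover $$T_1\mathrm{End}(\xi)=\{g\in\mathrm{End}(\xi): Rg=g\}=\{g\in L: Rg=g\}.$$ -/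

import Mathlib

open Bundle Filter Topology
open scoped NNReal ENNReal ComplexOrder

noncomputable section

/-! ### The base dynamics -/

/-- The orbit space `X = Y / G`, with the quotient topology. -/
abbrev OrbitSpace (G Y : Type*) [Group G] [MulAction G Y] : Type _ :=
  Quotient (MulAction.orbitRel G Y)

/-- The quotient map `p : Y → X`. -/
def orbitProj (G : Type*) {Y : Type*} [Group G] [MulAction G Y] (x : Y) : OrbitSpace G Y :=
  Quotient.mk (MulAction.orbitRel G Y) x

/-- The quotient distance on `X = Y / G`: the distance between the two orbits. -/
def orbitEDist {G Y : Type*} [Group G] [MulAction G Y] [MetricSpace Y]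
    (a b : OrbitSpace G Y) : ℝ≥0∞ :=
  ⨅ (x : Y) (y : Y) (_ : orbitProj G x = a) (_ : orbitProj G y = b), edist x y

/-- A strictly expansive homeomorphism `r̃` of `Y` (expansion constant `θ⁻¹ > 1`) which intertwines
the action of `G` with an endomorphism `A` of `G` whose image is a normal subgroup. -/
structure ExpansiveSystem (G Y : Type*) [Group G] [MetricSpace Y] [MulAction G Y] where
  /-- the homeomorphism `r̃` -/
  dil : Y ≃ₜ Y
  /-- the constant `θ` -/
  θ : ℝ
  /-- the endomorphism `A` -/
  A : G →* G
  θ_pos : 0 < θ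
  θ_lt_one : θ < 1
  expansive : ∀ x y : Y, dist x y ≤ θ * dist (dil x) (dil y)
  range_normal : A.range.Normal
  dil_smul : ∀ (g : G) (x : Y), dil (g • x) = A g • dil x

namespace ExpansiveSystem

variable {G Y : Type*} [Group G] [MetricSpace Y] [MulAction G Y] (S : ExpansiveSystem G Y)

/-- The map `r : X → X` with `r (p x) = p (r̃ x)`. -/
def baseMap : OrbitSpace G Y → OrbitSpace G Y :=
  Quotient.map S.dil (by
    intro a b hab
    obtain ⟨g, hg⟩ := MulAction.orbitRel_apply.mp hab
    refine MulAction.orbitRel_apply.mpr ⟨S.A g, ?_⟩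
    change S.A g • S.dil b = S.dil a
    rw [← S.dil_smul]
    exact congrArg S.dil hg)

theorem baseMap_orbitProj (x : Y) : S.baseMap (orbitProj G x) = orbitProj G (S.dil x) := rfl

/-- `g₁, …, g_q` is a complete system of representatives of the right cosets `(AG) g` of `AG`
in `G`: each `g` lies in exactly one of the cosets `(AG) gᵢ`. -/
def IsRightTransversal {q : ℕ} (rep : Fin q → G) : Prop :=
  ∀ g : G, ∃! i : Fin q, g * (rep i)⁻¹ ∈ S.A.range

/-- The inverse branches `ψᵢ = r̃⁻¹ ∘ gᵢ`. -/
def branch {q : ℕ} (rep : Fin q → G) (i : Fin q) (x : Y) : Y :=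
  S.dil.symm (rep i • x)

end ExpansiveSystem

theorem orbitProj_smul {G Y : Type*} [Group G] [MulAction G Y] (g : G) (x : Y) :
    orbitProj G (g • x) = orbitProj G x :=
  Quotient.sound (MulAction.orbitRel_apply.mpr ⟨g, rfl⟩)

namespace ExpansiveSystem

variable {G Y : Type*} [Group G] [MetricSpace Y] [MulAction G Y] (S : ExpansiveSystem G Y)

theorem baseMap_branch {q : ℕ} (rep : Fin q → G) (i : Fin q) (x : Y) :
    S.baseMap (orbitProj G (S.branch rep i x)) = orbitProj G x := by
  rw [baseMap_orbitProj, branch, Homeomorph.apply_symm_apply, orbitProj_smul]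

/-! ### The transfer operator -/

section Transfer

variable {E : OrbitSpace G Y → Type*} [∀ y, NormedAddCommGroup (E y)]
  [∀ y, InnerProductSpace ℂ (E y)]

/-- A bundle map `m : r^*ξ → ξ`, given by its fibre maps `m z : ξ_{r z} → ξ_z`, seen at a point `z`
with `r z = y` as a map `ξ_y → ξ_z`. -/
def fibreMap (m : ∀ z, E (S.baseMap z) →L[ℂ] E z) (z y : OrbitSpace G Y)
    (hz : S.baseMap z = y) : E y →L[ℂ] E z :=
  hz ▸ m z

theorem fibreMap_self (m : ∀ z, E (S.baseMap z) →L[ℂ] E z) (z : OrbitSpace G Y) :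
    S.fibreMap m z (S.baseMap z) rfl = m z := rfl

variable [∀ y, CompleteSpace (E y)]

/-- The endomorphism `m^*(z) h(z) m(z)` of `ξ_y`, for `r z = y`. -/
def transferTerm (m : ∀ z, E (S.baseMap z) →L[ℂ] E z) (h : ∀ y, E y →L[ℂ] E y)
    (z y : OrbitSpace G Y) (hz : S.baseMap z = y) : E y →L[ℂ] E y :=
  (ContinuousLinearMap.adjoint (S.fibreMap m z y hz)) ∘L (h z) ∘L (S.fibreMap m z y hz)

/-- The transfer operator
`(R h)(p x) = ∑ᵢ m^*(p ψᵢ x) h(p ψᵢ x) m(p ψᵢ x)`. It is written here with the representative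
`x = y.out` of `y`; `transferOp_orbitProj` shows that any other representative gives the same. -/
def transferOp (m : ∀ z, E (S.baseMap z) →L[ℂ] E z) {q : ℕ} (rep : Fin q → G)
    (h : ∀ y, E y →L[ℂ] E y) (y : OrbitSpace G Y) : E y →L[ℂ] E y :=
  ∑ i, S.transferTerm m h (orbitProj G (S.branch rep i y.out)) y
    ((S.baseMap_branch rep i y.out).trans (Quotient.out_eq y))

theorem transferOp_orbitProj (m : ∀ z, E (S.baseMap z) →L[ℂ] E z) {q : ℕ} (rep : Fin q → G)
    (hrep : S.IsRightTransversal rep) (h : ∀ y, E y →L[ℂ] E y) (x : Y) :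
    S.transferOp m rep h (orbitProj G x) =
      ∑ i, S.transferTerm m h (orbitProj G (S.branch rep i x)) (orbitProj G x)
        (S.baseMap_branch rep i x) := by
  have hout : orbitProj G (orbitProj G x).out = orbitProj G x := Quotient.out_eq _
  obtain ⟨a, ha⟩ := MulAction.orbitRel_apply.mp (Quotient.exact hout)
  have ha' : a • x = (orbitProj G x).out := ha
  choose σ hσ _ using fun i => hrep (rep i * a)
  have hinj : Function.Injective σ := by
    intro i j hij
    have hi := hσ i
    have hj := hσ j
    rw [← hij] at hj
    have hmem : rep i * (rep j)⁻¹ ∈ S.A.range := by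
      have h2 := S.A.range.mul_mem hi (S.A.range.inv_mem hj)
      have e : rep i * a * (rep (σ i))⁻¹ * (rep j * a * (rep (σ i))⁻¹)⁻¹
          = rep i * (rep j)⁻¹ := by group
      rwa [e] at h2
    have hself : rep i * (rep i)⁻¹ ∈ S.A.range := by simp [S.A.range.one_mem]
    exact (hrep (rep i)).unique hself hmem
  have hbij : Function.Bijective σ := Finite.injective_iff_bijective.mp hinj
  have hpt : ∀ i, orbitProj G (S.branch rep i (orbitProj G x).out)
      = orbitProj G (S.branch rep (σ i) x) := by
    intro i
    obtain ⟨b, hb⟩ := hσ i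
    have e1 : rep i • (orbitProj G x).out = S.A b • (rep (σ i) • x) := by
      rw [← ha', hb]
      simp only [smul_smul]
      congr 1
      group
    have e2 : S.branch rep i (orbitProj G x).out = b • S.branch rep (σ i) x := by
      apply S.dil.injective
      rw [S.dil_smul]
      simp only [branch, Homeomorph.apply_symm_apply]
      exact e1
    rw [e2, orbitProj_smul]
  have hterm : ∀ (z z' : OrbitSpace G Y) (hz : S.baseMap z = orbitProj G x)
      (hz' : S.baseMap z' = orbitProj G x), z = z' →
      S.transferTerm m h z _ hz = S.transferTerm m h z' _ hz' := by
    intro z z' hz hz' hzz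
    subst hzz
    rfl
  unfold transferOp
  rw [← hbij.sum_comp (fun i => S.transferTerm m h (orbitProj G (S.branch rep i x))
    (orbitProj G x) (S.baseMap_branch rep i x))]
  exact Finset.sum_congr rfl fun i _ => hterm _ _ _ _ (hpt i)

end Transfer

end ExpansiveSystem

/-! ### The bundle, its sections and its endomorphisms -/

section Bundles

variable {G Y : Type*} [Group G] [MetricSpace Y] [MulAction G Y] {d : ℕ}
  {E : OrbitSpace G Y → Type*} [∀ y, NormedAddCommGroup (E y)] [∀ y, InnerProductSpace ℂ (E y)]

/-- The sup-norm `‖h‖_∞ = sup_y ‖h(y)‖`, as an extended nonnegative real. -/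
def supNorm (h : ∀ y, E y →L[ℂ] E y) : ℝ≥0∞ := ⨆ y, ‖h y‖ₑ

/-- The pull-back `p^*s`, read in the identification `u` of `p^*ξ` with `Y × ℂ^d`. -/
def pullSection (u : ∀ x : Y, EuclideanSpace ℂ (Fin d) ≃ₗᵢ[ℂ] E (orbitProj G x))
    (s : ∀ y, E y) (x : Y) : EuclideanSpace ℂ (Fin d) :=
  (u x).symm (s (orbitProj G x))

/-- The norm `‖s‖₁ = sup_y ‖s(y)‖ + sup_{x,y} ‖p^*s(x) - p^*s(y)‖ / d(x,y)`. -/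
def lipNorm (u : ∀ x : Y, EuclideanSpace ℂ (Fin d) ≃ₗᵢ[ℂ] E (orbitProj G x))
    (s : ∀ y, E y) : ℝ≥0∞ :=
  (⨆ y, ‖s y‖ₑ) + ⨆ (x : Y) (y : Y), ‖pullSection u s x - pullSection u s y‖ₑ / edist x y

variable [TopologicalSpace (TotalSpace (EuclideanSpace ℂ (Fin d)) E)]

/-- The space `S₁` of the continuous sections `s` of `ξ` for which `p^*s` is Lipschitz. -/
def lipSections (u : ∀ x : Y, EuclideanSpace ℂ (Fin d) ≃ₗᵢ[ℂ] E (orbitProj G x)) :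
    Set (∀ y, E y) :=
  {s | Continuous (fun y => TotalSpace.mk' (EuclideanSpace ℂ (Fin d)) y (s y)) ∧
    ∃ K : ℝ≥0, LipschitzWith K (pullSection u s)}

/-- The operator norm `‖h‖₁` of `s ↦ h s` on `(S₁, ‖·‖₁)`. -/
def lipOpNorm (u : ∀ x : Y, EuclideanSpace ℂ (Fin d) ≃ₗᵢ[ℂ] E (orbitProj G x))
    (h : ∀ y, E y →L[ℂ] E y) : ℝ≥0∞ :=
  ⨆ (s : ∀ y, E y) (_ : s ∈ lipSections u) (_ : lipNorm u s ≤ 1), lipNorm u (fun y => h y (s y))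

variable [FiberBundle (EuclideanSpace ℂ (Fin d)) E] [VectorBundle ℂ (EuclideanSpace ℂ (Fin d)) E]

variable (d E) in
/-- The space `End(ξ)` of continuous bundle maps `ξ → ξ`: families `h` of fibre endomorphisms for
which `(y, v) ↦ (y, h(y) v)` is continuous on the total space of `ξ`. -/
def bundleEnd : Submodule ℂ (∀ y, E y →L[ℂ] E y) where
  carrier := {h | Continuous (fun v : TotalSpace (EuclideanSpace ℂ (Fin d)) E =>
    TotalSpace.mk' (EuclideanSpace ℂ (Fin d)) v.1 (h v.1 v.2))}
  zero_mem' := by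
    rw [Set.mem_ofPred_eq, continuous_iff_continuousAt]
    intro v
    refine (FiberBundle.continuousAt_totalSpace _ _).mpr
      ⟨(FiberBundle.continuous_proj (EuclideanSpace ℂ (Fin d)) E).continuousAt, ?_⟩
    refine (continuousAt_const (y := (0 : EuclideanSpace ℂ (Fin d)))).congr ?_
    have hmem : ∀ᶠ w : TotalSpace (EuclideanSpace ℂ (Fin d)) E in 𝓝 v,
        w.1 ∈ (trivializationAt (EuclideanSpace ℂ (Fin d)) E v.1).baseSet :=
      (FiberBundle.continuous_proj (EuclideanSpace ℂ (Fin d)) E).continuousAt.eventually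
        ((trivializationAt (EuclideanSpace ℂ (Fin d)) E v.1).open_baseSet.mem_nhds
          (FiberBundle.mem_baseSet_trivializationAt' v.1))
    filter_upwards [hmem] with w hw
    exact (((trivializationAt (EuclideanSpace ℂ (Fin d)) E v.1).linear ℂ hw).map_zero).symm
  add_mem' := by
    intro a b ha hb
    rw [Set.mem_ofPred_eq, continuous_iff_continuousAt] at *
    intro v
    have ha' := (FiberBundle.continuousAt_totalSpace _ _).mp (ha v)
    have hb' := (FiberBundle.continuousAt_totalSpace _ _).mp (hb v)
    refine (FiberBundle.continuousAt_totalSpace _ _).mpr ⟨ha'.1, ?_⟩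
    refine (ha'.2.add hb'.2).congr ?_
    have hmem : ∀ᶠ w : TotalSpace (EuclideanSpace ℂ (Fin d)) E in 𝓝 v,
        w.1 ∈ (trivializationAt (EuclideanSpace ℂ (Fin d)) E v.1).baseSet :=
      (FiberBundle.continuous_proj (EuclideanSpace ℂ (Fin d)) E).continuousAt.eventually
        ((trivializationAt (EuclideanSpace ℂ (Fin d)) E v.1).open_baseSet.mem_nhds
          (FiberBundle.mem_baseSet_trivializationAt' v.1))
    filter_upwards [hmem] with w hw
    exact (((trivializationAt (EuclideanSpace ℂ (Fin d)) E v.1).linear ℂ hw).map_add _ _).symm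
  smul_mem' := by
    intro c a ha
    rw [Set.mem_ofPred_eq, continuous_iff_continuousAt] at *
    intro v
    have ha' := (FiberBundle.continuousAt_totalSpace _ _).mp (ha v)
    refine (FiberBundle.continuousAt_totalSpace _ _).mpr ⟨ha'.1, ?_⟩
    refine (ha'.2.const_smul c).congr ?_
    have hmem : ∀ᶠ w : TotalSpace (EuclideanSpace ℂ (Fin d)) E in 𝓝 v,
        w.1 ∈ (trivializationAt (EuclideanSpace ℂ (Fin d)) E v.1).baseSet :=
      (FiberBundle.continuous_proj (EuclideanSpace ℂ (Fin d)) E).continuousAt.eventually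
        ((trivializationAt (EuclideanSpace ℂ (Fin d)) E v.1).open_baseSet.mem_nhds
          (FiberBundle.mem_baseSet_trivializationAt' v.1))
    filter_upwards [hmem] with w hw
    exact (((trivializationAt (EuclideanSpace ℂ (Fin d)) E v.1).linear ℂ hw).map_smul _ _).symm

/-- The algebra `L ⊆ End(ξ)` of the bounded endomorphisms of `(S₁, ‖·‖₁)`. -/
def lipEnd (u : ∀ x : Y, EuclideanSpace ℂ (Fin d) ≃ₗᵢ[ℂ] E (orbitProj G x)) :
    Set (∀ y, E y →L[ℂ] E y) :=
  {h | h ∈ bundleEnd d E ∧ (∀ s ∈ lipSections u, (fun y => h y (s y)) ∈ lipSections u) ∧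
    lipOpNorm u h < ⊤}

/-- A matrix `(h_{ij})` over `End(ξ)` is positive: at every point `y` it is a positive operator
on `ξ_y ⊕ ⋯ ⊕ ξ_y`. -/
def MatrixPositive {n : ℕ} (M : Matrix (Fin n) (Fin n) (bundleEnd d E)) : Prop :=
  ∀ (y : OrbitSpace G Y) (v : Fin n → E y),
    0 ≤ ∑ i, ∑ j, inner ℂ (v i) ((M i j : ∀ y, E y →L[ℂ] E y) y (v j))

/-- Complete positivity of a linear map on `End(ξ)`: all its matrix amplifications preserve
positivity. -/
def IsCompletelyPositive (T : bundleEnd d E →ₗ[ℂ] bundleEnd d E) : Prop :=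
  ∀ (n : ℕ) (M : Matrix (Fin n) (Fin n) (bundleEnd d E)),
    MatrixPositive M → MatrixPositive (M.map T)

/-- `φ` is a trivializing system of `ξ` with Lipschitz transition functions (with respect to the
quotient distance on `X`). -/
structure IsLipschitzTrivializingSystem {ι : Type*}
    (φ : ι → Trivialization (EuclideanSpace ℂ (Fin d))
      (TotalSpace.proj : TotalSpace (EuclideanSpace ℂ (Fin d)) E → OrbitSpace G Y))
    [∀ i, (φ i).IsLinear ℂ] : Prop where
  cover : ∀ y, ∃ i, y ∈ (φ i).baseSet
  lipschitz : ∀ i j, ∃ K : ℝ≥0, ∀ a ∈ (φ i).baseSet ∩ (φ j).baseSet,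
    ∀ b ∈ (φ i).baseSet ∩ (φ j).baseSet,
      edist (((φ i).coordChangeL ℂ (φ j) a : EuclideanSpace ℂ (Fin d) →L[ℂ] EuclideanSpace ℂ (Fin d)))
        ((φ i).coordChangeL ℂ (φ j) b : EuclideanSpace ℂ (Fin d) →L[ℂ] EuclideanSpace ℂ (Fin d))
      ≤ K * orbitEDist a b

/-- The fibrewise isometries `u x : ℂ^d → ξ_{p x}` form a Lipschitz continuous bundle
isomorphism `Y × ℂ^d → p^*ξ`: in every trivialization `φ i`, the matrix `φ_i(p x) u_x` is a
Lipschitz function of `x ∈ p⁻¹(U_i)`. -/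
def IsLipschitzFrame {ι : Type*}
    (φ : ι → Trivialization (EuclideanSpace ℂ (Fin d))
      (TotalSpace.proj : TotalSpace (EuclideanSpace ℂ (Fin d)) E → OrbitSpace G Y))
    [∀ i, (φ i).IsLinear ℂ]
    (u : ∀ x : Y, EuclideanSpace ℂ (Fin d) ≃ₗᵢ[ℂ] E (orbitProj G x)) : Prop :=
  ∀ i, ∃ K : ℝ≥0, LipschitzOnWith K
    (fun x : Y => ((φ i).continuousLinearMapAt ℂ (orbitProj G x)) ∘L
      ((u x).toContinuousLinearEquiv : EuclideanSpace ℂ (Fin d) →L[ℂ] E (orbitProj G x)))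
    {x : Y | orbitProj G x ∈ (φ i).baseSet}

end Bundles

/-- The matrix function `m₀ = p^*m : Y → M_d(ℂ)`, `m₀(x) = u_x⁻¹ m(p x) u_{r̃ x}`, of a bundle map
`m : r^*ξ → ξ`. -/
def pullBundleMap {G Y : Type*} [Group G] [MetricSpace Y] [MulAction G Y] {d : ℕ}
    {E : OrbitSpace G Y → Type*} [∀ y, NormedAddCommGroup (E y)]
    [∀ y, InnerProductSpace ℂ (E y)] (S : ExpansiveSystem G Y)
    (u : ∀ x : Y, EuclideanSpace ℂ (Fin d) ≃ₗᵢ[ℂ] E (orbitProj G x))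
    (m : ∀ z, E (S.baseMap z) →L[ℂ] E z) (x : Y) :
    EuclideanSpace ℂ (Fin d) →L[ℂ] EuclideanSpace ℂ (Fin d) :=
  ((u x).symm.toContinuousLinearEquiv : E (orbitProj G x) →L[ℂ] EuclideanSpace ℂ (Fin d)) ∘L
    (S.fibreMap m (orbitProj G x) (orbitProj G (S.dil x)) (S.baseMap_orbitProj x)) ∘L
    ((u (S.dil x)).toContinuousLinearEquiv :
      EuclideanSpace ℂ (Fin d) →L[ℂ] E (orbitProj G (S.dil x)))

/-- The Cesàro mean `k⁻¹ ∑_{j=1}^k R^j g`. -/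
def cesaroMean {V : Type*} [AddCommGroup V] [Module ℂ V] (R : V → V) (k : ℕ) (g : V) : V :=
  (k : ℂ)⁻¹ • ∑ j ∈ Finset.Icc 1 k, R^[j] g

end

/-!
Through the frames `u`, an endomorphism `h` of `ξ` becomes a matrix function `pullEnd u h` on `Y`,
compatible with the changes of frame along the orbits of `G`, and the transfer operator becomes
`f ↦ ∑ᵢ aᵢ^* (f ∘ ψᵢ) aᵢ` with the `θ`-contractions `ψᵢ` and the Lipschitz weights
`aᵢ(x) = u_{ψᵢ x}⁻¹ m u_x` (`pullEnd_transferOp`). The `n`-th iterate is the analogous sum over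
words `w` of length `n`, with composite weights `a_w`.

The bound on the powers of `R`, applied to the identity, says that `∑_w |a_w(x) v|² ≤ C |v|²` for
all `n` and `x`. Writing `a_w(x) - a_w(y)` as a telescoping sum over the position of the letter at
which `x` is replaced by `y`, and using this bound on both sides of that position, the increments
form a geometric series, and uniformly in `n`
`(∑_w |(a_w(x) - a_w(y)) v|²)^{1/2} ≤ const · |v| d(x, y)`
(`sqrt_sum_norm_wordWeight_sub_sq_le`). Hence
`‖Rⁿf(x) - Rⁿf(y)‖ ≤ C sup_w ‖f(ψ_w x) - f(ψ_w y)‖ + const · ‖f‖_∞ d(x, y)`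
(`norm_iterate_weightedTransfer_sub_le`), where `d(ψ_w x, ψ_w y) ≤ θⁿ d(x, y)`.

Everything follows from this estimate. Pull-backs of continuous endomorphisms are uniformly
continuous, so their iterates are equicontinuous; their norms are attained on a compact set which
meets all orbits, so by Arzelà–Ascoli the Cesàro means have a cluster point, and for a power bounded
operator the means then converge to it (`tendsto_cesaroMean_of_mapClusterPt`). For a fixed point `f`
the estimate holds with all `n` at once, and `n → ∞` shows that `f` is Lipschitz with constant
`const · ‖f‖_∞` (`norm_sub_le_of_weightedTransfer_eq`); so fixed points lie in `L`, with norm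
bounded by a multiple of the sup-norm. The sup-norm is in turn bounded by a multiple of the norm of
`L`, because every vector extends to a Lipschitz section of comparable norm
(`exists_lipSection_eq`). Complete positivity passes to the limit from the iterates, which are sums
of congruences.

Two uniform facts come from the compactness of `X`: the changes of frame `x ↦ u_{gx}⁻¹ u_x` are
Lipschitz with a constant independent of `g` (`exists_deckChange_lipschitz`), and the action has a
positive injectivity radius (`exists_injectivity_radius`).
-/

/-! ### Weighted transfer operators over contracting branches -/

section SquareSums

variable {H J : Type*} [NormedAddCommGroup H] [Fintype J]

/-- Minkowski's inequality for square sums of vectors. -/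
theorem sqrt_sum_norm_add_sq_le (p q : J → H) :
    √(∑ j, ‖p j + q j‖ ^ 2) ≤ √(∑ j, ‖p j‖ ^ 2) + √(∑ j, ‖q j‖ ^ 2) := by
  have h := norm_add_le (WithLp.toLp 2 p : PiLp 2 (fun _ : J => H)) (WithLp.toLp 2 q)
  simpa [PiLp.norm_eq_of_L2] using h

theorem sum_norm_mul_norm_le_sqrt (p q : J → H) {A B : ℝ}
    (hp : ∑ j, ‖p j‖ ^ 2 ≤ A) (hq : ∑ j, ‖q j‖ ^ 2 ≤ B) :
    ∑ j, ‖p j‖ * ‖q j‖ ≤ √A * √B :=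
  (Real.sum_mul_le_sqrt_mul_sqrt _ _ _).trans
    (mul_le_mul (Real.sqrt_le_sqrt hp) (Real.sqrt_le_sqrt hq) (by positivity) (by positivity))

end SquareSums

section WeightedTransfer

universe w

variable {Y H : Type*} {I : Type w} [NormedAddCommGroup H] [InnerProductSpace ℂ H] [CompleteSpace H]
  [Fintype I]

/-- The transfer operator `f ↦ ∑ᵢ aᵢ^* (f ∘ ψᵢ) aᵢ` on operator-valued functions on `Y`, with
branches `ψ i : Y → Y` and weights `a i : Y → B(H)`. -/
noncomputable def weightedTransfer (ψ : I → Y → Y) (a : I → Y → H →L[ℂ] H)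
    (f : Y → H →L[ℂ] H) (x : Y) : H →L[ℂ] H :=
  ∑ i, ContinuousLinearMap.adjoint (a i x) ∘L f (ψ i x) ∘L a i x

/-- The composite branch along a word; the first letter is applied first. -/
def wordBranch (ψ : I → Y → Y) : (n : ℕ) → (Fin n → I) → Y → Y
  | 0, _, x => x
  | n + 1, w, x => wordBranch ψ n (Fin.tail w) (ψ (w 0) x)

/-- The composite weight along a word, i.e. the product of the weights of its letters taken at
the successive points of the orbit. -/
noncomputable def wordWeight (ψ : I → Y → Y) (a : I → Y → H →L[ℂ] H) :
    (n : ℕ) → (Fin n → I) → Y → H →L[ℂ] H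
  | 0, _, _ => ContinuousLinearMap.id ℂ H
  | n + 1, w, x => wordWeight ψ a n (Fin.tail w) (ψ (w 0) x) ∘L a (w 0) x

theorem sum_words_succ {M : Type*} [AddCommMonoid M] (n : ℕ) (F : I → (Fin n → I) → M) :
    ∑ w : Fin (n + 1) → I, F (w 0) (Fin.tail w) = ∑ i, ∑ w, F i w := by
  rw [← Fintype.sum_prod_type']
  exact Fintype.sum_equiv (Fin.consEquiv (fun _ => I)).symm _ _ (fun w => rfl)

theorem inner_iterate_weightedTransfer (ψ : I → Y → Y) (a : I → Y → H →L[ℂ] H)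
    (f : Y → H →L[ℂ] H) (n : ℕ) (x : Y) (v v' : H) :
    inner ℂ v ((weightedTransfer ψ a)^[n] f x v') =
      ∑ w : Fin n → I, inner ℂ (wordWeight ψ a n w x v)
        (f (wordBranch ψ n w x) (wordWeight ψ a n w x v')) := by
  induction n generalizing x v v' with
  | zero => simp [wordWeight, wordBranch]
  | succ n ih =>
    rw [Function.iterate_succ_apply']
    simp only [weightedTransfer, sum_apply, inner_sum,
      ContinuousLinearMap.comp_apply, ContinuousLinearMap.adjoint_inner_right, ih]
    rw [← sum_words_succ n (fun i w => inner ℂ (wordWeight ψ a n w (ψ i x) (a i x v))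
      (f (wordBranch ψ n w (ψ i x)) (wordWeight ψ a n w (ψ i x) (a i x v'))))]
    rfl

theorem exists_weightedTransfer_linearMap (ψ : I → Y → Y) (a : I → Y → H →L[ℂ] H) :
    ∃ R : (Y → H →L[ℂ] H) →ₗ[ℂ] (Y → H →L[ℂ] H), ⇑R = weightedTransfer ψ a :=
  ⟨{ toFun := weightedTransfer ψ a
     map_add' := fun f g => by
       ext x v
       simp [weightedTransfer, Finset.sum_add_distrib]
     map_smul' := fun c f => by
       ext x v
       simp [weightedTransfer, Finset.smul_sum] }, rfl⟩

variable {ψ : I → Y → Y} {a : I → Y → H →L[ℂ] H}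

/-- The iterates of the constant function `1` control the square sums of the word weights. -/
theorem sum_norm_wordWeight_sq_le {C : ℝ}
    (hC : ∀ n x, ‖(weightedTransfer ψ a)^[n] (fun _ => ContinuousLinearMap.id ℂ H) x‖ ≤ C)
    (n : ℕ) (x : Y) (v : H) :
    ∑ w : Fin n → I, ‖wordWeight ψ a n w x v‖ ^ 2 ≤ C * ‖v‖ ^ 2 := by
  have h := inner_iterate_weightedTransfer ψ a (fun _ => ContinuousLinearMap.id ℂ H) n x v v
  have h2 : ((∑ w : Fin n → I, ‖wordWeight ψ a n w x v‖ ^ 2 : ℝ) : ℂ) =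
      inner ℂ v ((weightedTransfer ψ a)^[n] (fun _ => ContinuousLinearMap.id ℂ H) x v) := by
    rw [h]
    simp [inner_self_eq_norm_sq_to_K]
  have h3 : ∑ w : Fin n → I, ‖wordWeight ψ a n w x v‖ ^ 2 =
      ‖inner ℂ v ((weightedTransfer ψ a)^[n] (fun _ => ContinuousLinearMap.id ℂ H) x v)‖ := by
    rw [← h2, Complex.norm_real, Real.norm_of_nonneg (by positivity)]
  rw [h3]
  calc _ ≤ ‖v‖ * ‖(weightedTransfer ψ a)^[n] (fun _ => ContinuousLinearMap.id ℂ H) x v‖ :=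
        norm_inner_le_norm _ _
    _ ≤ ‖v‖ * (C * ‖v‖) := by
        gcongr
        exact ContinuousLinearMap.le_of_opNorm_le _ (hC n x) v
    _ = C * ‖v‖ ^ 2 := by ring

omit [CompleteSpace H] in
theorem ContinuousLinearMap.norm_le_of_forall_norm_inner_le (T : H →L[ℂ] H) {B : ℝ} (hB : 0 ≤ B)
    (h : ∀ v v', ‖inner ℂ v (T v')‖ ≤ B * ‖v‖ * ‖v'‖) : ‖T‖ ≤ B := by
  refine T.opNorm_le_bound hB fun v' => ?_
  have h1 := h (T v') v'
  rw [inner_self_eq_norm_sq_to_K, norm_pow, RCLike.norm_ofReal,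
    abs_norm] at h1
  rcases (norm_nonneg (T v')).eq_or_lt with h0 | h0
  · rw [← h0]; positivity
  · nlinarith

omit [CompleteSpace H] in
theorem norm_weight_le_sqrt {C : ℝ} (hC0 : 0 ≤ C)
    (hw : ∀ n x v, ∑ w : Fin n → I, ‖wordWeight ψ a n w x v‖ ^ 2 ≤ C * ‖v‖ ^ 2) (i : I) (x : Y) :
    ‖a i x‖ ≤ √C := by
  refine ContinuousLinearMap.opNorm_le_bound _ (by positivity) fun v => ?_
  refine le_of_sq_le_sq ?_ (by positivity)
  rw [mul_pow, Real.sq_sqrt hC0]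
  refine le_trans ?_ (hw 1 x v)
  have e : wordWeight ψ a 1 (fun _ => i) x v = a i x v := rfl
  rw [← e]
  exact Finset.single_le_sum (f := fun w : Fin 1 → I => ‖wordWeight ψ a 1 w x v‖ ^ 2)
    (fun _ _ => by positivity) (Finset.mem_univ (fun _ => i))

theorem norm_iterate_weightedTransfer_le {C : ℝ} (hC0 : 0 ≤ C)
    (hw : ∀ n x v, ∑ w : Fin n → I, ‖wordWeight ψ a n w x v‖ ^ 2 ≤ C * ‖v‖ ^ 2)
    {f : Y → H →L[ℂ] H} {B : ℝ} (hB : 0 ≤ B) (hf : ∀ x, ‖f x‖ ≤ B) (n : ℕ) (x : Y) :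
    ‖(weightedTransfer ψ a)^[n] f x‖ ≤ C * B := by
  refine ContinuousLinearMap.norm_le_of_forall_norm_inner_le _ (by positivity) fun v v' => ?_
  rw [inner_iterate_weightedTransfer]
  calc _ ≤ ∑ w : Fin n → I, B * (‖wordWeight ψ a n w x v‖ * ‖wordWeight ψ a n w x v'‖) := by
        refine (norm_sum_le _ _).trans (Finset.sum_le_sum fun w _ => ?_)
        calc _ ≤ ‖wordWeight ψ a n w x v‖ * (B * ‖wordWeight ψ a n w x v'‖) :=
              (norm_inner_le_norm _ _).trans (by
                gcongr; exact (f _).le_of_opNorm_le (hf _) _)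
          _ = _ := by ring
    _ ≤ B * (√(C * ‖v‖ ^ 2) * √(C * ‖v'‖ ^ 2)) := by
        rw [← Finset.mul_sum]
        gcongr
        exact sum_norm_mul_norm_le_sqrt _ _ (hw n x v) (hw n x v')
    _ = (√C * √C) * B * ‖v‖ * ‖v'‖ := by
        rw [Real.sqrt_mul hC0, Real.sqrt_mul hC0, Real.sqrt_sq (norm_nonneg _),
          Real.sqrt_sq (norm_nonneg _)]
        ring
    _ = _ := by rw [Real.mul_self_sqrt hC0]

variable [PseudoMetricSpace Y]

omit [Fintype I] in
theorem dist_wordBranch_le {θ : ℝ} (hθ0 : 0 ≤ θ)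
    (hψ : ∀ i x y, dist (ψ i x) (ψ i y) ≤ θ * dist x y) (n : ℕ) (w : Fin n → I) (x y : Y) :
    dist (wordBranch ψ n w x) (wordBranch ψ n w y) ≤ θ ^ n * dist x y := by
  induction n generalizing x y with
  | zero => simp [wordBranch]
  | succ n ih =>
    refine (ih (Fin.tail w) _ _).trans ?_
    rw [pow_succ, mul_assoc]
    gcongr
    exact hψ _ _ _

omit [CompleteSpace H] in
/-- The telescoping estimate for the word weights. It is stated for a finite family of starting
points `x j`, `y j` with vectors `b j`, because the induction on the length of the words replaces
such a family by its images under all first letters: the distances shrink by `θ`, while the square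
sums stay bounded by the same constant `M`. -/
theorem sqrt_sum_norm_wordWeight_sub_sq_le {θ C L : ℝ} (hθ0 : 0 ≤ θ) (hθ1 : θ < 1) (hC0 : 0 ≤ C)
    (hL : 0 ≤ L)
    (hψ : ∀ i x y, dist (ψ i x) (ψ i y) ≤ θ * dist x y)
    (ha : ∀ i x y, ‖a i x - a i y‖ ≤ L * dist x y)
    (hw : ∀ n x v, ∑ w : Fin n → I, ‖wordWeight ψ a n w x v‖ ^ 2 ≤ C * ‖v‖ ^ 2) {n : ℕ} :
    ∀ {J : Type w} [Fintype J] (x y : J → Y) (b : J → H) (δ M : ℝ), 0 ≤ δ → 0 ≤ M →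
      (∀ j, dist (x j) (y j) ≤ δ) →
      (∀ k, ∑ j, ∑ w : Fin k → I, ‖wordWeight ψ a k w (x j) (b j)‖ ^ 2 ≤ M ^ 2) →
      √(∑ j, ∑ w : Fin n → I,
        ‖wordWeight ψ a n w (x j) (b j) - wordWeight ψ a n w (y j) (b j)‖ ^ 2) ≤
        √(C * Fintype.card I) * L / (1 - θ) * M * δ := by
  have hθ' : 0 < 1 - θ := by linarith
  induction n with
  | zero =>
    intro J _ x y b δ M hδ hM _ _
    simp only [wordWeight, sub_self, norm_zero, ne_eq, OfNat.ofNat_ne_zero, not_false_eq_true,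
      zero_pow, Finset.sum_const_zero, Real.sqrt_zero]
    positivity
  | succ n ih =>
    intro J _ x y b δ M hδ hM hd hb
    -- the difference along `i·w` is a difference along `w` after `i`, plus the change of `a i`
    let P : (J × I) × (Fin n → I) → H := fun z =>
      wordWeight ψ a n z.2 (ψ z.1.2 (x z.1.1)) (a z.1.2 (x z.1.1) (b z.1.1)) -
      wordWeight ψ a n z.2 (ψ z.1.2 (y z.1.1)) (a z.1.2 (x z.1.1) (b z.1.1))
    let Q : (J × I) × (Fin n → I) → H := fun z =>
      wordWeight ψ a n z.2 (ψ z.1.2 (y z.1.1)) ((a z.1.2 (x z.1.1) - a z.1.2 (y z.1.1)) (b z.1.1))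
    have hsplit : ∑ j, ∑ w : Fin (n + 1) → I,
        ‖wordWeight ψ a (n + 1) w (x j) (b j) - wordWeight ψ a (n + 1) w (y j) (b j)‖ ^ 2 =
        ∑ z, ‖P z + Q z‖ ^ 2 := by
      rw [Fintype.sum_prod_type, Fintype.sum_prod_type]
      refine Finset.sum_congr rfl fun j _ => ?_
      rw [← sum_words_succ n (fun i w => ‖P ((j, i), w) + Q ((j, i), w)‖ ^ 2)]
      refine Finset.sum_congr rfl fun w _ => ?_
      simp [P, Q, wordWeight]
    have hP : √(∑ z, ‖P z‖ ^ 2) ≤ √(C * Fintype.card I) * L / (1 - θ) * M * (θ * δ) := by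
      rw [Fintype.sum_prod_type]
      refine ih (J := J × I) (fun z => ψ z.2 (x z.1)) (fun z => ψ z.2 (y z.1))
        (fun z => a z.2 (x z.1) (b z.1)) (θ * δ) M (by positivity) hM ?_ ?_
      · intro z
        exact (hψ _ _ _).trans (by gcongr; exact hd _)
      · intro k
        refine le_trans (le_of_eq ?_) (hb (k + 1))
        rw [Fintype.sum_prod_type]
        refine Finset.sum_congr rfl fun j _ => ?_
        exact (sum_words_succ k
          (fun i w => ‖wordWeight ψ a k w (ψ i (x j)) (a i (x j) (b j))‖ ^ 2)).symm
    have hQ : √(∑ z, ‖Q z‖ ^ 2) ≤ √(C * Fintype.card I) * L * M * δ := by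
      have hb0 : ∑ j, ‖b j‖ ^ 2 ≤ M ^ 2 := by
        simpa [wordWeight] using hb 0
      have h1 : ∑ z, ‖Q z‖ ^ 2 ≤ C * Fintype.card I * (L * M * δ) ^ 2 := by
        rw [Fintype.sum_prod_type]
        calc _ ≤ ∑ z : J × I, C * (L * δ) ^ 2 * ‖b z.1‖ ^ 2 := by
              refine Finset.sum_le_sum fun z _ =>
                (hw n (ψ z.2 (y z.1)) ((a z.2 (x z.1) - a z.2 (y z.1)) (b z.1))).trans ?_
              rw [mul_assoc, ← mul_pow]
              gcongr
              refine (ContinuousLinearMap.le_opNorm _ _).trans ?_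
              gcongr
              exact (ha _ _ _).trans (by gcongr; exact hd _)
          _ = C * Fintype.card I * (L * δ) ^ 2 * ∑ j, ‖b j‖ ^ 2 := by
              rw [Fintype.sum_prod_type]
              simp only [Finset.sum_const, Finset.card_univ, nsmul_eq_mul, Finset.mul_sum]
              refine Finset.sum_congr rfl fun j _ => ?_
              ring
          _ ≤ C * Fintype.card I * (L * δ) ^ 2 * M ^ 2 := by gcongr
          _ = _ := by ring
      refine (Real.sqrt_le_sqrt h1).trans (le_of_eq ?_)
      rw [Real.sqrt_mul (by positivity), Real.sqrt_sq (by positivity)]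
      ring
    rw [hsplit]
    refine (sqrt_sum_norm_add_sq_le P Q).trans ((add_le_add hP hQ).trans (le_of_eq ?_))
    field_simp
    ring

/-- A uniform modulus of continuity for the iterates of a transfer operator with contracting
branches. -/
theorem norm_iterate_weightedTransfer_sub_le {θ C L : ℝ} (hθ0 : 0 ≤ θ) (hθ1 : θ < 1) (hC0 : 0 ≤ C)
    (hL : 0 ≤ L)
    (hψ : ∀ i x y, dist (ψ i x) (ψ i y) ≤ θ * dist x y)
    (ha : ∀ i x y, ‖a i x - a i y‖ ≤ L * dist x y)
    (hw : ∀ n x v, ∑ w : Fin n → I, ‖wordWeight ψ a n w x v‖ ^ 2 ≤ C * ‖v‖ ^ 2)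
    {f : Y → H →L[ℂ] H} {B ε : ℝ} (hB : 0 ≤ B) (hε : 0 ≤ ε) (hf : ∀ x, ‖f x‖ ≤ B)
    (n : ℕ) (x y : Y)
    (hxy : ∀ w, ‖f (wordBranch ψ n w x) - f (wordBranch ψ n w y)‖ ≤ ε) :
    ‖(weightedTransfer ψ a)^[n] f x - (weightedTransfer ψ a)^[n] f y‖ ≤
      C * ε + 2 * C * (√(C * Fintype.card I) * L / (1 - θ)) * B * dist x y := by
  set D := √(C * Fintype.card I) * L / (1 - θ) with hD
  have hθ' : 0 < 1 - θ := by linarith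
  have hD0 : 0 ≤ D := by positivity
  have hs : √C * √C = C := Real.mul_self_sqrt hC0
  have hdiff : ∀ v, ∑ w : Fin n → I, ‖(wordWeight ψ a n w x v - wordWeight ψ a n w y v)‖ ^ 2 ≤
      (D * (√C * ‖v‖) * dist x y) ^ 2 := by
    intro v
    have h := sqrt_sum_norm_wordWeight_sub_sq_le hθ0 hθ1 hC0 hL hψ ha hw (n := n)
      (J := PUnit) (fun _ => x) (fun _ => y) (fun _ => v) (dist x y) (√C * ‖v‖) (by positivity)
      (by positivity) (fun _ => le_rfl) (fun k => by
        rw [mul_pow, Real.sq_sqrt hC0]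
        simpa using hw k x v)
    rw [Real.sqrt_le_left (by positivity)] at h
    simpa [D] using h
  have hbd : ∀ x v, ∑ w : Fin n → I, ‖wordWeight ψ a n w x v‖ ^ 2 ≤ (√C * ‖v‖) ^ 2 := by
    intro x v
    rw [mul_pow, Real.sq_sqrt hC0]
    exact hw n x v
  refine ContinuousLinearMap.norm_le_of_forall_norm_inner_le _ (by positivity) fun v v' => ?_
  rw [sub_apply, inner_sub_right, inner_iterate_weightedTransfer,
    inner_iterate_weightedTransfer, ← Finset.sum_sub_distrib]
  have e1 : ∑ w : Fin n → I, ‖wordWeight ψ a n w x v - wordWeight ψ a n w y v‖ *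
      ‖wordWeight ψ a n w x v'‖ ≤ (D * (√C * ‖v‖) * dist x y) * (√C * ‖v'‖) := by
    refine (sum_norm_mul_norm_le_sqrt _ _ (hdiff v) (hbd x v')).trans (le_of_eq ?_)
    rw [Real.sqrt_sq (by positivity), Real.sqrt_sq (by positivity)]
  have e2 : ∑ w : Fin n → I, ‖wordWeight ψ a n w y v‖ *
      ‖wordWeight ψ a n w x v'‖ ≤ (√C * ‖v‖) * (√C * ‖v'‖) := by
    refine (sum_norm_mul_norm_le_sqrt _ _ (hbd y v) (hbd x v')).trans (le_of_eq ?_)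
    rw [Real.sqrt_sq (by positivity), Real.sqrt_sq (by positivity)]
  have e3 : ∑ w : Fin n → I, ‖wordWeight ψ a n w y v‖ *
      ‖wordWeight ψ a n w x v' - wordWeight ψ a n w y v'‖ ≤
      (√C * ‖v‖) * (D * (√C * ‖v'‖) * dist x y) := by
    refine (sum_norm_mul_norm_le_sqrt _ _ (hbd y v) (hdiff v')).trans (le_of_eq ?_)
    rw [Real.sqrt_sq (by positivity), Real.sqrt_sq (by positivity)]
  calc _ ≤ ∑ w : Fin n → I, (B * (‖wordWeight ψ a n w x v - wordWeight ψ a n w y v‖ *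
            ‖wordWeight ψ a n w x v'‖) +
          ε * (‖wordWeight ψ a n w y v‖ * ‖wordWeight ψ a n w x v'‖) +
          B * (‖wordWeight ψ a n w y v‖ *
            ‖wordWeight ψ a n w x v' - wordWeight ψ a n w y v'‖)) := by
        refine (norm_sum_le _ _).trans (Finset.sum_le_sum fun w _ => ?_)
        set p := wordWeight ψ a n w x v
        set p' := wordWeight ψ a n w y v
        set r := wordWeight ψ a n w x v'
        set r' := wordWeight ψ a n w y v'
        set F := f (wordBranch ψ n w x)
        set F' := f (wordBranch ψ n w y)
        have heq : inner ℂ p (F r) - inner ℂ p' (F' r') =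
            inner ℂ (p - p') (F r) + inner ℂ p' ((F - F') r) + inner ℂ p' (F' (r - r')) := by
          simp only [inner_sub_left, inner_sub_right, map_sub, sub_apply]
          ring
        rw [heq]
        refine (norm_add₃_le).trans (add_le_add (add_le_add ?_ ?_) ?_)
        · calc _ ≤ ‖p - p'‖ * (B * ‖r‖) := (norm_inner_le_norm _ _).trans (by
                gcongr; exact F.le_of_opNorm_le (hf _) _)
            _ = _ := by ring
        · calc _ ≤ ‖p'‖ * (ε * ‖r‖) := (norm_inner_le_norm _ _).trans (by
                gcongr; exact (F - F').le_of_opNorm_le (hxy w) _)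
            _ = _ := by ring
        · calc _ ≤ ‖p'‖ * (B * ‖r - r'‖) := (norm_inner_le_norm _ _).trans (by
                gcongr; exact F'.le_of_opNorm_le (hf _) _)
            _ = _ := by ring
    _ ≤ B * ((D * (√C * ‖v‖) * dist x y) * (√C * ‖v'‖)) + ε * ((√C * ‖v‖) * (√C * ‖v'‖)) +
        B * ((√C * ‖v‖) * (D * (√C * ‖v'‖) * dist x y)) := by
        rw [Finset.sum_add_distrib, Finset.sum_add_distrib, ← Finset.mul_sum, ← Finset.mul_sum,
          ← Finset.mul_sum]
        gcongr
    _ = (√C * √C) * (ε + 2 * D * B * dist x y) * ‖v‖ * ‖v'‖ := by ring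
    _ = _ := by rw [hs]; ring

/-- A bounded uniformly continuous fixed point is Lipschitz: its own modulus of continuity is
absorbed by the contraction of the branches under iteration. -/
theorem norm_sub_le_of_weightedTransfer_eq {θ C L : ℝ} (hθ0 : 0 ≤ θ) (hθ1 : θ < 1) (hC0 : 0 ≤ C)
    (hL : 0 ≤ L)
    (hψ : ∀ i x y, dist (ψ i x) (ψ i y) ≤ θ * dist x y)
    (ha : ∀ i x y, ‖a i x - a i y‖ ≤ L * dist x y)
    (hw : ∀ n x v, ∑ w : Fin n → I, ‖wordWeight ψ a n w x v‖ ^ 2 ≤ C * ‖v‖ ^ 2)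
    {f : Y → H →L[ℂ] H} {B : ℝ} (hB : 0 ≤ B) (hf : ∀ x, ‖f x‖ ≤ B) (hfu : UniformContinuous f)
    (hfix : weightedTransfer ψ a f = f) (x y : Y) :
    ‖f x - f y‖ ≤ 2 * C * (√(C * Fintype.card I) * L / (1 - θ)) * B * dist x y := by
  have key : ∀ ε > 0, ‖f x - f y‖ ≤
      C * ε + 2 * C * (√(C * Fintype.card I) * L / (1 - θ)) * B * dist x y := by
    intro ε hε
    obtain ⟨δ, hδ, hfδ⟩ := Metric.uniformContinuous_iff.mp hfu ε hε
    have ht : Tendsto (fun n : ℕ => θ ^ n * dist x y) atTop (𝓝 (0 * dist x y)) :=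
      (tendsto_pow_atTop_nhds_zero_of_lt_one hθ0 hθ1).mul_const _
    rw [zero_mul] at ht
    obtain ⟨n, hn⟩ := (ht.eventually (gt_mem_nhds hδ)).exists
    have h := norm_iterate_weightedTransfer_sub_le hθ0 hθ1 hC0 hL hψ ha hw hB hε.le hf n x y
      (fun w => by
        rw [← dist_eq_norm]
        exact (hfδ ((dist_wordBranch_le hθ0 hψ n w x y).trans_lt hn)).le)
    rwa [Function.iterate_fixed hfix] at h
  have ht : Tendsto (fun ε : ℝ =>
      C * ε + 2 * C * (√(C * Fintype.card I) * L / (1 - θ)) * B * dist x y) (𝓝[>] 0)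
      (𝓝 (C * 0 + 2 * C * (√(C * Fintype.card I) * L / (1 - θ)) * B * dist x y)) :=
    Tendsto.mono_left (Continuous.tendsto (by fun_prop) 0) nhdsWithin_le_nhds
  rw [mul_zero, zero_add] at ht
  exact ge_of_tendsto ht (eventually_nhdsWithin_of_forall key)

end WeightedTransfer

/-! ### A mean ergodic theorem -/

section MeanErgodic

section Algebra

variable {V : Type*} [AddCommGroup V] [Module ℂ V]

theorem exists_sub_cesaroMean_eq {R : V →ₗ[ℂ] V} (k : ℕ) (hk : k ≠ 0) (x : V) :
    ∃ h, x - cesaroMean R k x = h - R h := by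
  have key : ∀ j : ℕ, ∃ h, x - R^[j] x = h - R h := by
    intro j
    induction j with
    | zero => exact ⟨0, by simp⟩
    | succ j ih =>
      obtain ⟨h, hh⟩ := ih
      refine ⟨h + R^[j] x, ?_⟩
      rw [map_add, Function.iterate_succ_apply', add_sub_add_comm, ← hh]
      abel
  choose h hh using key
  refine ⟨(k : ℂ)⁻¹ • ∑ j ∈ Finset.Icc 1 k, h j, ?_⟩
  have hk' : (k : ℂ) ≠ 0 := by exact_mod_cast hk
  rw [map_smul, map_sum, ← smul_sub, ← Finset.sum_sub_distrib, cesaroMean]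
  rw [← Finset.sum_congr rfl fun j _ => hh j, Finset.sum_sub_distrib, smul_sub]
  simp [← Nat.cast_smul_eq_nsmul ℂ, smul_smul, hk']

theorem cesaroMean_sub (R : V →ₗ[ℂ] V) (k : ℕ) (x y : V) :
    cesaroMean R k (x - y) = cesaroMean R k x - cesaroMean R k y := by
  simp only [cesaroMean, ← Module.End.pow_apply, map_sub, Finset.sum_sub_distrib, smul_sub]

theorem cesaroMean_add (R : V →ₗ[ℂ] V) (k : ℕ) (x y : V) :
    cesaroMean R k (x + y) = cesaroMean R k x + cesaroMean R k y := by
  simp only [cesaroMean, ← Module.End.pow_apply, map_add, Finset.sum_add_distrib, smul_add]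

theorem cesaroMean_smul (R : V →ₗ[ℂ] V) (k : ℕ) (c : ℂ) (x : V) :
    cesaroMean R k (c • x) = c • cesaroMean R k x := by
  simp only [cesaroMean, ← Module.End.pow_apply, map_smul, ← Finset.smul_sum]
  rw [smul_comm]

theorem cesaroMean_sub_map (R : V →ₗ[ℂ] V) (k : ℕ) (h : V) :
    cesaroMean R k (h - R h) = (k : ℂ)⁻¹ • (R^[1] h - R^[k + 1] h) := by
  rw [cesaroMean]
  congr 1
  induction k with
  | zero => simp
  | succ k ih =>
    rw [Finset.sum_Icc_succ_top (by omega), ih]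
    simp only [← Module.End.pow_apply, map_sub]
    simp only [Module.End.pow_apply, ← Function.iterate_succ_apply R]
    abel

theorem cesaroMean_of_fixed {R : V → V} {x : V} (hx : R x = x) {k : ℕ} (hk : k ≠ 0) :
    cesaroMean R k x = x := by
  have hk' : (k : ℂ) ≠ 0 := by exact_mod_cast hk
  simp [cesaroMean, Function.iterate_fixed hx, ← Nat.cast_smul_eq_nsmul ℂ, smul_smul, hk']

end Algebra

variable {V : Type*} [NormedAddCommGroup V] [NormedSpace ℂ V]

theorem norm_inv_smul_sum_Icc_le {v : ℕ → V} {B : ℝ} (hB : 0 ≤ B) (hv : ∀ j, ‖v j‖ ≤ B) (k : ℕ) :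
    ‖(k : ℂ)⁻¹ • ∑ j ∈ Finset.Icc 1 k, v j‖ ≤ B := by
  rcases eq_or_ne k 0 with rfl | hk
  · simpa using hB
  have hk' : (k : ℝ) ≠ 0 := by exact_mod_cast hk
  rw [norm_smul, norm_inv, Complex.norm_natCast]
  calc _ ≤ (k : ℝ)⁻¹ * ∑ j ∈ Finset.Icc 1 k, B := by
        gcongr
        exact (norm_sum_le _ _).trans (Finset.sum_le_sum fun j _ => hv j)
    _ = B := by simp [hk']

theorem norm_cesaroMean_le {R : V → V} {C : ℝ} (hC0 : 0 ≤ C) {x : V}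
    (hx : ∀ n, ‖R^[n] x‖ ≤ C * ‖x‖) (k : ℕ) : ‖cesaroMean R k x‖ ≤ C * ‖x‖ :=
  norm_inv_smul_sum_Icc_le (by positivity) hx k

theorem tendsto_cesaroMean_sub_map {R : V →ₗ[ℂ] V} {C : ℝ}
    (hC : ∀ n x, ‖R^[n] x‖ ≤ C * ‖x‖) (h : V) :
    Tendsto (fun k => cesaroMean R k (h - R h)) atTop (𝓝 0) := by
  have h0 : Tendsto (fun k : ℕ => (k : ℝ)⁻¹ * (C * ‖h‖ + C * ‖h‖)) atTop
      (𝓝 (0 * (C * ‖h‖ + C * ‖h‖))) :=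
    (tendsto_inv_atTop_zero.comp tendsto_natCast_atTop_atTop).mul_const _
  rw [zero_mul] at h0
  refine squeeze_zero_norm (fun k => ?_) h0
  rw [cesaroMean_sub_map, norm_smul, norm_inv, Complex.norm_natCast]
  gcongr
  exact (norm_sub_le _ _).trans (add_le_add (hC _ _) (hC _ _))

/-- Mean ergodic theorem: for a power bounded operator, the Cesàro means of `x` converge to a fixed
point as soon as they have a cluster point. The difference of `x` and the cluster point is a limit
of vectors `h - R h`, whose Cesàro means tend to `0`. -/
theorem tendsto_cesaroMean_of_mapClusterPt {R : V →L[ℂ] V} {C : ℝ} (hC0 : 0 ≤ C)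
    (hC : ∀ n x, ‖R^[n] x‖ ≤ C * ‖x‖) {x y : V}
    (hy : MapClusterPt y atTop (fun k => cesaroMean R k x)) :
    R y = y ∧ Tendsto (fun k => cesaroMean R k x) atTop (𝓝 y) := by
  have hcomm : ∀ k, cesaroMean R k (R x) = R (cesaroMean R k x) := by
    intro k
    simp only [cesaroMean, map_smul, map_sum, ← Function.iterate_succ_apply,
      Function.iterate_succ_apply']
  have hfix : R y = y := by
    have h1 : MapClusterPt (y - R y) atTop (fun k => cesaroMean R k (x - R x)) := by
      have := MapClusterPt.continuousAt_comp (F := atTop) (f := fun z => z - R z) (by fun_prop) hy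
      refine this.congrFun (Eventually.of_forall fun k => ?_)
      have e := cesaroMean_sub (R : V →ₗ[ℂ] V) k x (R x)
      simp only [ContinuousLinearMap.coe_coe] at e
      exact (e.trans (by rw [hcomm]; rfl)).symm
    have h2 := tendsto_cesaroMean_sub_map (R := (R : V →ₗ[ℂ] V)) hC x
    have h3 : y - R y = 0 := by
      by_contra hne
      exact (h1.neBot).ne (((disjoint_nhds_nhds.mpr hne).mono_right h2).eq_bot)
    exact (sub_eq_zero.mp h3).symm
  refine ⟨hfix, ?_⟩
  rw [Metric.tendsto_atTop]
  intro ε hε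
  obtain ⟨k₀, hk₀, hk₀'⟩ := ((hy.frequently (Metric.ball_mem_nhds y
    (show 0 < ε / 2 / (C + 1) by positivity))).and_eventually (eventually_ne_atTop 0)).exists
  obtain ⟨h, hh⟩ := exists_sub_cesaroMean_eq (R := (R : V →ₗ[ℂ] V)) k₀ hk₀' x
  simp only [ContinuousLinearMap.coe_coe] at hh
  have h2 := tendsto_cesaroMean_sub_map (R := (R : V →ₗ[ℂ] V)) hC h
  rw [Metric.tendsto_atTop] at h2
  obtain ⟨N, hN⟩ := h2 (ε / 2) (by positivity)
  refine ⟨max N 1, fun k hk => ?_⟩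
  have hk1 : k ≠ 0 := by have := le_trans (le_max_right N 1) hk; omega
  set z := cesaroMean R k₀ x - y with hz
  have hdec : cesaroMean R k x - y = cesaroMean R k (h - R h) + cesaroMean R k z := by
    have e1 := cesaroMean_sub (R : V →ₗ[ℂ] V) k x (cesaroMean R k₀ x)
    have e2 := cesaroMean_sub (R : V →ₗ[ℂ] V) k (cesaroMean R k₀ x) y
    simp only [ContinuousLinearMap.coe_coe] at e1 e2
    rw [← hh, e1, hz, e2, cesaroMean_of_fixed hfix hk1]
    abel
  have hzn : ‖z‖ < ε / 2 / (C + 1) := by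
    rw [hz, ← dist_eq_norm]; exact hk₀
  rw [dist_eq_norm, hdec]
  have h5 : ‖cesaroMean R k (h - R h)‖ < ε / 2 := by
    have := hN k (le_trans (le_max_left _ _) hk)
    rwa [dist_zero_right] at this
  have h6 : ‖cesaroMean R k z‖ ≤ ε / 2 := by
    refine (norm_cesaroMean_le hC0 (fun n => hC n z) k).trans ?_
    calc C * ‖z‖ ≤ (C + 1) * (ε / 2 / (C + 1)) := by gcongr; linarith
      _ = ε / 2 := by field_simp
  linarith [norm_add_le (cesaroMean R k (h - R h)) (cesaroMean R k z)]

end MeanErgodic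

/-! ### Frames of the pulled-back bundle -/

section Frames

theorem norm_comp_sub_comp_le {H : Type*} [NormedAddCommGroup H] [NormedSpace ℂ H]
    (A A' B B' : H →L[ℂ] H) :
    ‖A ∘L B - A' ∘L B'‖ ≤ ‖A - A'‖ * ‖B‖ + ‖A'‖ * ‖B - B'‖ := by
  have h : A ∘L B - A' ∘L B' = (A - A') ∘L B + A' ∘L (B - B') := by
    ext v; simp
  rw [h]
  exact (norm_add_le _ _).trans (add_le_add (ContinuousLinearMap.opNorm_comp_le _ _)
    (ContinuousLinearMap.opNorm_comp_le _ _))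

/-- The identification of two fibres over equal base points. -/
def fibreCast {X : Type*} (E : X → Type*) [∀ y, NormedAddCommGroup (E y)]
    [∀ y, InnerProductSpace ℂ (E y)] {y y' : X} (h : y = y') : E y →L[ℂ] E y' :=
  h ▸ ContinuousLinearMap.id ℂ (E y)

section FibreCast

variable {X : Type*} {E : X → Type*} [∀ y, NormedAddCommGroup (E y)]
    [∀ y, InnerProductSpace ℂ (E y)]

theorem fibreCast_self {y : X} (v : E y) : fibreCast E (rfl : y = y) v = v := rfl

theorem fibreCast_fibreCast {y y' y'' : X} (h : y = y') (h' : y' = y'') (v : E y) :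
    fibreCast E h' (fibreCast E h v) = fibreCast E (h.trans h') v := by
  subst h; subst h'; rfl

theorem norm_fibreCast {y y' : X} (h : y = y') (v : E y) : ‖fibreCast E h v‖ = ‖v‖ := by
  subst h; rfl

theorem apply_fibreCast (f : ∀ y, E y →L[ℂ] E y) {y y' : X} (h : y = y') (v : E y) :
    f y' (fibreCast E h v) = fibreCast E h (f y v) := by
  subst h; rfl

end FibreCast

variable {G Y : Type*} [Group G] [MulAction G Y] {d : ℕ}
  {E : OrbitSpace G Y → Type*} [∀ y, NormedAddCommGroup (E y)] [∀ y, InnerProductSpace ℂ (E y)]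
  (u : ∀ x : Y, EuclideanSpace ℂ (Fin d) ≃ₗᵢ[ℂ] E (orbitProj G x))

/-- The change of frame `u_{x'}⁻¹ u_x` between two points `x`, `x'` of the same orbit. -/
noncomputable def frameChange {x x' : Y} (h : orbitProj G x = orbitProj G x') :
    EuclideanSpace ℂ (Fin d) →L[ℂ] EuclideanSpace ℂ (Fin d) :=
  ((u x').symm.toContinuousLinearEquiv : E (orbitProj G x') →L[ℂ] EuclideanSpace ℂ (Fin d)) ∘L
    fibreCast E h ∘L
    ((u x).toContinuousLinearEquiv : EuclideanSpace ℂ (Fin d) →L[ℂ] E (orbitProj G x))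

theorem frameChange_apply {x x' : Y} (h : orbitProj G x = orbitProj G x')
    (v : EuclideanSpace ℂ (Fin d)) :
    frameChange u h v = (u x').symm (fibreCast E h (u x v)) := rfl

theorem frameChange_self {x : Y} (v : EuclideanSpace ℂ (Fin d)) :
    frameChange u (rfl : orbitProj G x = orbitProj G x) v = v := by
  simp [frameChange_apply, fibreCast_self]

theorem frameChange_frameChange {x x' x'' : Y} (h : orbitProj G x = orbitProj G x')
    (h' : orbitProj G x' = orbitProj G x'') (v : EuclideanSpace ℂ (Fin d)) :
    frameChange u h' (frameChange u h v) = frameChange u (h.trans h') v := by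
  simp [frameChange_apply, fibreCast_fibreCast]

theorem norm_frameChange_apply {x x' : Y} (h : orbitProj G x = orbitProj G x')
    (v : EuclideanSpace ℂ (Fin d)) : ‖frameChange u h v‖ = ‖v‖ := by
  simp [frameChange_apply, norm_fibreCast]

theorem norm_frameChange_le {x x' : Y} (h : orbitProj G x = orbitProj G x') :
    ‖frameChange u h‖ ≤ 1 :=
  ContinuousLinearMap.opNorm_le_bound _ zero_le_one fun v => by
    rw [norm_frameChange_apply, one_mul]

/-- The change of frame `u_{gx}⁻¹ u_x` along the deck transformation `g`. -/
noncomputable def deckChange (g : G) (x : Y) :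
    EuclideanSpace ℂ (Fin d) →L[ℂ] EuclideanSpace ℂ (Fin d) :=
  frameChange u (orbitProj_smul g x).symm

theorem frameChange_eq_deckChange {g : G} {x x' : Y} (hx : x' = g • x)
    (h : orbitProj G x = orbitProj G x') : frameChange u h = deckChange u g x := by
  subst hx; rfl

theorem norm_deckChange_apply (g : G) (x : Y) (v : EuclideanSpace ℂ (Fin d)) :
    ‖deckChange u g x v‖ = ‖v‖ := norm_frameChange_apply u _ v

theorem norm_deckChange_le (g : G) (x : Y) : ‖deckChange u g x‖ ≤ 1 := norm_frameChange_le u _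

theorem deckChange_mul_apply (g g' : G) (x : Y) (v : EuclideanSpace ℂ (Fin d)) :
    deckChange u (g * g') x v = deckChange u g (g' • x) (deckChange u g' x v) := by
  rw [deckChange.eq_1 u g, deckChange.eq_1 u g', frameChange_frameChange,
    frameChange_eq_deckChange u (g := g * g') (mul_smul g g' x).symm]

theorem deckChange_inv_apply (g : G) (x : Y) (v : EuclideanSpace ℂ (Fin d)) :
    deckChange u g⁻¹ (g • x) (deckChange u g x v) = v := by
  rw [← deckChange_mul_apply]
  rw [← frameChange_eq_deckChange u (x' := x) (by simp) rfl, frameChange_self]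

/-- The endomorphism `u_x⁻¹ h(p x) u_x` of `ℂ^d`. -/
noncomputable def pullEnd (h : ∀ y, E y →L[ℂ] E y) (x : Y) :
    EuclideanSpace ℂ (Fin d) →L[ℂ] EuclideanSpace ℂ (Fin d) :=
  ((u x).symm.toContinuousLinearEquiv : E (orbitProj G x) →L[ℂ] EuclideanSpace ℂ (Fin d)) ∘L
    h (orbitProj G x) ∘L
    ((u x).toContinuousLinearEquiv : EuclideanSpace ℂ (Fin d) →L[ℂ] E (orbitProj G x))

theorem pullEnd_apply (h : ∀ y, E y →L[ℂ] E y) (x : Y) (v : EuclideanSpace ℂ (Fin d)) :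
    pullEnd u h x v = (u x).symm (h (orbitProj G x) (u x v)) := rfl

theorem pullEnd_add (h h' : ∀ y, E y →L[ℂ] E y) :
    pullEnd u (h + h') = pullEnd u h + pullEnd u h' := by
  ext x v : 2; simp [pullEnd_apply]

theorem pullEnd_smul (c : ℂ) (h : ∀ y, E y →L[ℂ] E y) :
    pullEnd u (c • h) = c • pullEnd u h := by
  ext x v : 2; simp [pullEnd_apply]

theorem pullEnd_frameChange (h : ∀ y, E y →L[ℂ] E y) {x x' : Y}
    (e : orbitProj G x = orbitProj G x') (v : EuclideanSpace ℂ (Fin d)) :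
    pullEnd u h x' (frameChange u e v) = frameChange u e (pullEnd u h x v) := by
  simp [pullEnd_apply, frameChange_apply, apply_fibreCast]

theorem norm_pullEnd (h : ∀ y, E y →L[ℂ] E y) (x : Y) :
    ‖pullEnd u h x‖ = ‖h (orbitProj G x)‖ := by
  apply le_antisymm
  · refine ContinuousLinearMap.opNorm_le_bound _ (norm_nonneg _) fun v => ?_
    rw [pullEnd_apply, LinearIsometryEquiv.norm_map]
    exact (ContinuousLinearMap.le_opNorm _ _).trans (by rw [LinearIsometryEquiv.norm_map])
  · refine ContinuousLinearMap.opNorm_le_bound _ (norm_nonneg _) fun v => ?_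
    have := (pullEnd u h x).le_opNorm ((u x).symm v)
    simpa [pullEnd_apply] using this

theorem orbitProj_surjective : Function.Surjective (orbitProj G : Y → OrbitSpace G Y) :=
  Quotient.mk_surjective

theorem pullEnd_injective : Function.Injective (pullEnd u) := by
  intro h h' e
  funext y
  obtain ⟨x, rfl⟩ := orbitProj_surjective y
  ext v
  have := congrArg (fun f => u x (f x ((u x).symm v))) e
  simpa [pullEnd_apply] using this

/-- Functions on `Y` which are compatible with the changes of frame descend to `ξ`. -/
theorem exists_pullEnd_eq {f : Y → EuclideanSpace ℂ (Fin d) →L[ℂ] EuclideanSpace ℂ (Fin d)}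
    (hf : ∀ (x x' : Y) (e : orbitProj G x = orbitProj G x') (v : EuclideanSpace ℂ (Fin d)),
      f x' (frameChange u e v) = frameChange u e (f x v)) :
    ∃ h : ∀ y, E y →L[ℂ] E y, pullEnd u h = f := by
  have hout : ∀ y : OrbitSpace G Y, orbitProj G y.out = y := Quotient.out_eq
  refine ⟨fun y => fibreCast E (hout y) ∘L
    ((u y.out).toContinuousLinearEquiv : EuclideanSpace ℂ (Fin d) →L[ℂ] E (orbitProj G y.out)) ∘L
    f y.out ∘L ((u y.out).symm.toContinuousLinearEquiv :
      E (orbitProj G y.out) →L[ℂ] EuclideanSpace ℂ (Fin d)) ∘L fibreCast E (hout y).symm, ?_⟩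
  ext x v : 2
  have h1 := hf x (orbitProj G x).out (hout (orbitProj G x)).symm v
  have h2 : frameChange u (hout (orbitProj G x)) (f (orbitProj G x).out
      (frameChange u (hout (orbitProj G x)).symm v)) = f x v := by
    rw [h1, frameChange_frameChange, frameChange_self]
  rw [← h2]
  rfl

/-- A vector function on `Y` which is compatible with the changes of frame descends to a section
of `ξ`. -/
theorem exists_pullSection_eq {f : Y → EuclideanSpace ℂ (Fin d)}
    (hf : ∀ (x x' : Y) (e : orbitProj G x = orbitProj G x'), f x' = frameChange u e (f x)) :
    ∃ s : ∀ y, E y, pullSection u s = f := by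
  have hout : ∀ y : OrbitSpace G Y, orbitProj G y.out = y := Quotient.out_eq
  refine ⟨fun y => fibreCast E (hout y) (u y.out (f y.out)), ?_⟩
  ext x : 1
  rw [hf _ _ (hout (orbitProj G x))]
  rfl

theorem norm_pullSection (s : ∀ y, E y) (x : Y) : ‖pullSection u s x‖ = ‖s (orbitProj G x)‖ := by
  simp [pullSection]

theorem pullSection_apply_end (h : ∀ y, E y →L[ℂ] E y) (s : ∀ y, E y) (x : Y) :
    pullSection u (fun y => h y (s y)) x = pullEnd u h x (pullSection u s x) := by
  simp [pullSection, pullEnd_apply]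

end Frames

/-! ### Continuity through the frames -/

theorem orbitProj_eventually_mem {G Y : Type*} [Group G] [TopologicalSpace Y] [MulAction G Y]
    (hp : IsQuotientCoveringMap (orbitProj G : Y → OrbitSpace G Y) G)
    {U : Set (OrbitSpace G Y)} (hU : IsOpen U) {x : Y} (hx : orbitProj G x ∈ U) :
    ∀ᶠ x' in 𝓝 x, orbitProj G x' ∈ U :=
  hp.continuous.continuousAt.eventually (hU.mem_nhds hx)

section FrameContinuity

variable {G Y : Type*} [Group G] [MetricSpace Y] [MulAction G Y] {d : ℕ}
  {E : OrbitSpace G Y → Type*}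
  [TopologicalSpace (TotalSpace (EuclideanSpace ℂ (Fin d)) E)]
  [∀ y, NormedAddCommGroup (E y)] [∀ y, InnerProductSpace ℂ (E y)]
  [FiberBundle (EuclideanSpace ℂ (Fin d)) E]

/-- The matrix of the frame `u` at `x` in the trivialization `e`. -/
noncomputable def frameMatrix (e : Trivialization (EuclideanSpace ℂ (Fin d))
      (TotalSpace.proj : TotalSpace (EuclideanSpace ℂ (Fin d)) E → OrbitSpace G Y))
    [e.IsLinear ℂ] (u : ∀ x : Y, EuclideanSpace ℂ (Fin d) ≃ₗᵢ[ℂ] E (orbitProj G x)) (x : Y) :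
    EuclideanSpace ℂ (Fin d) →L[ℂ] EuclideanSpace ℂ (Fin d) :=
  (e.continuousLinearMapAt ℂ (orbitProj G x)) ∘L
      ((u x).toContinuousLinearEquiv : EuclideanSpace ℂ (Fin d) →L[ℂ] E (orbitProj G x))

/-- The inverse of `frameMatrix`, over the domain of the trivialization. -/
noncomputable def frameMatrixInv (e : Trivialization (EuclideanSpace ℂ (Fin d))
      (TotalSpace.proj : TotalSpace (EuclideanSpace ℂ (Fin d)) E → OrbitSpace G Y))
    [e.IsLinear ℂ] (u : ∀ x : Y, EuclideanSpace ℂ (Fin d) ≃ₗᵢ[ℂ] E (orbitProj G x)) (x : Y) :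
    EuclideanSpace ℂ (Fin d) →L[ℂ] EuclideanSpace ℂ (Fin d) :=
  ((u x).symm.toContinuousLinearEquiv : E (orbitProj G x) →L[ℂ] EuclideanSpace ℂ (Fin d)) ∘L
    e.symmL ℂ (orbitProj G x)

variable (e : Trivialization (EuclideanSpace ℂ (Fin d))
      (TotalSpace.proj : TotalSpace (EuclideanSpace ℂ (Fin d)) E → OrbitSpace G Y))
    [e.IsLinear ℂ] (u : ∀ x : Y, EuclideanSpace ℂ (Fin d) ≃ₗᵢ[ℂ] E (orbitProj G x))

theorem frameMatrix_apply {x : Y} (hx : orbitProj G x ∈ e.baseSet)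
    (v : EuclideanSpace ℂ (Fin d)) :
    frameMatrix e u x v = (e (TotalSpace.mk' _ (orbitProj G x) (u x v))).2 := by
  rw [frameMatrix, ContinuousLinearMap.comp_apply,
    Trivialization.continuousLinearMapAt_apply_of_mem ℂ e hx]
  rfl

theorem frameMatrixInv_frameMatrix {x : Y} (hx : orbitProj G x ∈ e.baseSet)
    (v : EuclideanSpace ℂ (Fin d)) : frameMatrixInv e u x (frameMatrix e u x v) = v := by
  change (u x).symm (e.symmL ℂ _ (e.continuousLinearMapAt ℂ _ (u x v))) = v
  rw [e.symmL_continuousLinearMapAt hx, LinearIsometryEquiv.symm_apply_apply]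

theorem frameMatrix_frameMatrixInv {x : Y} (hx : orbitProj G x ∈ e.baseSet)
    (v : EuclideanSpace ℂ (Fin d)) : frameMatrix e u x (frameMatrixInv e u x v) = v := by
  simp [frameMatrix, frameMatrixInv, e.continuousLinearMapAt_symmL hx]

theorem frameMatrix_frameChange {x x' : Y} (h : orbitProj G x = orbitProj G x')
    (v : EuclideanSpace ℂ (Fin d)) :
    frameMatrix e u x' (frameChange u h v) = frameMatrix e u x v := by
  have key : ∀ {y y' : OrbitSpace G Y} (h : y = y') (w : E y),
      e.continuousLinearMapAt ℂ y' (fibreCast E h w) = e.continuousLinearMapAt ℂ y w := by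
    intro y y' h w; subst h; rfl
  simp [frameMatrix, frameChange_apply, key]

variable {u}

/-- Over the domain of `e`, invertibility makes the inverse frame matrix continuous wherever the
frame matrix is. -/
theorem continuousAt_frameMatrixInv {x : Y}
    (hx : ∀ᶠ x' in 𝓝 x, orbitProj G x' ∈ e.baseSet)
    (hc : ContinuousAt (frameMatrix e u) x) : ContinuousAt (frameMatrixInv e u) x := by
  have hinv : ∀ x', orbitProj G x' ∈ e.baseSet →
      Ring.inverse (frameMatrix e u x') = frameMatrixInv e u x' := by
    intro x' hx'
    let U : (EuclideanSpace ℂ (Fin d) →L[ℂ] EuclideanSpace ℂ (Fin d))ˣ :=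
      ⟨frameMatrix e u x', frameMatrixInv e u x',
        ContinuousLinearMap.ext (frameMatrix_frameMatrixInv e u hx'),
        ContinuousLinearMap.ext (frameMatrixInv_frameMatrix e u hx')⟩
    exact Ring.inverse_unit U
  have hx0 := hx.self_of_nhds
  let U : (EuclideanSpace ℂ (Fin d) →L[ℂ] EuclideanSpace ℂ (Fin d))ˣ :=
      ⟨frameMatrix e u x, frameMatrixInv e u x,
        ContinuousLinearMap.ext (frameMatrix_frameMatrixInv e u hx0),
        ContinuousLinearMap.ext (frameMatrixInv_frameMatrix e u hx0)⟩
  have h1 : ContinuousAt (fun x' => Ring.inverse (frameMatrix e u x')) x :=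
    ContinuousAt.comp (f := frameMatrix e u) (NormedRing.inverse_continuousAt U) hc
  exact h1.congr (hx.mono hinv)

variable {ι : Type*} {φ : ι → Trivialization (EuclideanSpace ℂ (Fin d))
      (TotalSpace.proj : TotalSpace (EuclideanSpace ℂ (Fin d)) E → OrbitSpace G Y)}
    [∀ i, (φ i).IsLinear ℂ]

theorem IsLipschitzFrame.continuousAt
    (hp : IsQuotientCoveringMap (orbitProj G : Y → OrbitSpace G Y) G) (hu : IsLipschitzFrame φ u)
    {i : ι} {x : Y} (hx : orbitProj G x ∈ (φ i).baseSet) :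
    ContinuousAt (frameMatrix (φ i) u) x := by
  obtain ⟨K, hK⟩ := hu i
  exact hK.continuousOn.continuousAt (orbitProj_eventually_mem hp (φ i).open_baseSet hx)

/-- The bundle isomorphism `(x, v) ↦ u_x v` is continuous into the total space of `ξ`. -/
theorem continuous_frame (hp : IsQuotientCoveringMap (orbitProj G : Y → OrbitSpace G Y) G)
    (hφ : IsLipschitzTrivializingSystem φ) (hu : IsLipschitzFrame φ u) :
    Continuous (fun z : Y × EuclideanSpace ℂ (Fin d) =>
      (TotalSpace.mk' (EuclideanSpace ℂ (Fin d)) (orbitProj G z.1) (u z.1 z.2))) := by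
  rw [continuous_iff_continuousAt]
  rintro ⟨x, v⟩
  obtain ⟨i, hi⟩ := hφ.cover (orbitProj G x)
  have hev : ∀ᶠ z : Y × EuclideanSpace ℂ (Fin d) in 𝓝 (x, v),
      orbitProj G z.1 ∈ (φ i).baseSet :=
    continuousAt_fst.eventually (orbitProj_eventually_mem hp (φ i).open_baseSet hi)
  rw [ContinuousAt, (φ i).tendsto_nhds_iff ((φ i).mem_source.mpr hi)]
  refine ⟨(hp.continuous.comp continuous_fst).continuousAt, ?_⟩
  have hc : ContinuousAt (fun z : Y × EuclideanSpace ℂ (Fin d) => frameMatrix (φ i) u z.1 z.2)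
      (x, v) := by
    refine ContinuousAt.clm_apply ?_ continuousAt_snd
    exact ContinuousAt.comp (f := Prod.fst) (x := (x, v)) (hu.continuousAt hp hi) continuousAt_fst
  have h0 := frameMatrix_apply (φ i) u hi v
  rw [ContinuousAt] at hc
  simp only [h0] at hc
  refine hc.congr' ?_
  filter_upwards [hev] with z hz
  exact frameMatrix_apply (φ i) u hz z.2

theorem continuous_section_of_pullSection
    (hp : IsQuotientCoveringMap (orbitProj G : Y → OrbitSpace G Y) G)
    (hφ : IsLipschitzTrivializingSystem φ) (hu : IsLipschitzFrame φ u) {s : ∀ y, E y}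
    (hs : Continuous (pullSection u s)) :
    Continuous (fun y => TotalSpace.mk' (EuclideanSpace ℂ (Fin d)) y (s y)) := by
  rw [hp.toIsQuotientMap.continuous_iff]
  have := (continuous_frame hp hφ hu).comp (continuous_id.prodMk hs)
  refine this.congr fun x => ?_
  simp [pullSection]

variable [VectorBundle ℂ (EuclideanSpace ℂ (Fin d)) E]

theorem continuous_pullEnd (hp : IsQuotientCoveringMap (orbitProj G : Y → OrbitSpace G Y) G)
    (hφ : IsLipschitzTrivializingSystem φ) (hu : IsLipschitzFrame φ u)
    {h : ∀ y, E y →L[ℂ] E y} (hh : h ∈ bundleEnd d E) : Continuous (pullEnd u h) := by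
  rw [continuous_clm_apply]
  intro v
  rw [continuous_iff_continuousAt]
  intro x
  obtain ⟨i, hi⟩ := hφ.cover (orbitProj G x)
  have h1 : ContinuousAt (fun x' : Y => TotalSpace.mk' (EuclideanSpace ℂ (Fin d))
      (orbitProj G x') (h (orbitProj G x') (u x' v))) x :=
    (Continuous.comp (g := fun v : TotalSpace (EuclideanSpace ℂ (Fin d)) E =>
      TotalSpace.mk' (EuclideanSpace ℂ (Fin d)) v.1 (h v.1 v.2)) hh
      ((continuous_frame hp hφ hu).comp (continuous_id.prodMk continuous_const))).continuousAt
  rw [ContinuousAt, (φ i).tendsto_nhds_iff ((φ i).mem_source.mpr hi)] at h1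
  have h2 : ContinuousAt (fun x' => frameMatrixInv (φ i) u x'
      ((φ i) (TotalSpace.mk' (EuclideanSpace ℂ (Fin d))
      (orbitProj G x') (h (orbitProj G x') (u x' v)))).2) x :=
    ContinuousAt.clm_apply (continuousAt_frameMatrixInv (φ i)
      (orbitProj_eventually_mem hp (φ i).open_baseSet hi) (hu.continuousAt hp hi)) h1.2
  refine h2.congr ?_
  filter_upwards [orbitProj_eventually_mem hp (φ i).open_baseSet hi] with x' hx'
  have h3 := frameMatrix_apply (φ i) u hx' (pullEnd u h x' v)
  rw [pullEnd_apply, LinearIsometryEquiv.apply_symm_apply] at h3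
  rw [← h3, frameMatrixInv_frameMatrix _ _ hx', pullEnd_apply]

/-- An endomorphism is continuous as soon as its pull-back is: local sections of the covering
`p` provide, over small open sets, continuous frames of `ξ`. -/
theorem mem_bundleEnd_of_continuous_pullEnd
    (hp : IsQuotientCoveringMap (orbitProj G : Y → OrbitSpace G Y) G)
    (hφ : IsLipschitzTrivializingSystem φ) (hu : IsLipschitzFrame φ u)
    {h : ∀ y, E y →L[ℂ] E y} (hh : Continuous (pullEnd u h)) : h ∈ bundleEnd d E := by
  change Continuous _
  rw [continuous_iff_continuousAt]
  rintro ⟨y, v⟩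
  obtain ⟨x, rfl⟩ := orbitProj_surjective y
  obtain ⟨i, hi⟩ := hφ.cover (orbitProj G x)
  have hloc := hp.isCoveringMap.isLocalHomeomorph
  let σ := hloc.localInverseAt x
  have hσx : σ (orbitProj G x) = x := hloc.localInverseAt_apply_self
  have hσc : ContinuousAt σ (orbitProj G x) :=
    σ.continuousAt hloc.apply_self_mem_localInverseAt_source
  have hσp : ∀ᶠ y in 𝓝 (orbitProj G x), orbitProj G (σ y) = y := by
    filter_upwards [σ.open_source.mem_nhds hloc.apply_self_mem_localInverseAt_source] with y hy
    exact hloc.apply_localInverseAt_of_mem hy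
  set w₀ : TotalSpace (EuclideanSpace ℂ (Fin d)) E := ⟨orbitProj G x, v⟩ with hw₀
  have hproj : ContinuousAt (TotalSpace.proj : TotalSpace (EuclideanSpace ℂ (Fin d)) E → _) w₀ :=
    (FiberBundle.continuous_proj _ _).continuousAt
  have hσw : ContinuousAt (fun w : TotalSpace (EuclideanSpace ℂ (Fin d)) E => σ w.1) w₀ :=
    ContinuousAt.comp (f := TotalSpace.proj) hσc hproj
  have hσw' : Tendsto (fun w : TotalSpace (EuclideanSpace ℂ (Fin d)) E => σ w.1) (𝓝 w₀) (𝓝 x) := by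
    have := hσw.tendsto
    rwa [show σ w₀.1 = x from hσx] at this
  have hinv : ContinuousAt (frameMatrixInv (φ i) u) (σ w₀.1) := by
    rw [show σ w₀.1 = x from hσx]
    exact continuousAt_frameMatrixInv (φ i)
      (orbitProj_eventually_mem hp (φ i).open_baseSet hi) (hu.continuousAt hp hi)
  have hsnd : ContinuousAt (fun w => ((φ i) w).2) w₀ :=
    continuousAt_snd.comp ((φ i).continuousAt ((φ i).mem_source.mpr hi))
  have hcoord : ContinuousAt (fun w : TotalSpace (EuclideanSpace ℂ (Fin d)) E =>
      frameMatrixInv (φ i) u (σ w.1) ((φ i) w).2) w₀ :=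
    ContinuousAt.clm_apply
      (ContinuousAt.comp (f := fun w : TotalSpace (EuclideanSpace ℂ (Fin d)) E => σ w.1) hinv hσw)
      hsnd
  have htot : ContinuousAt (fun w : TotalSpace (EuclideanSpace ℂ (Fin d)) E =>
      TotalSpace.mk' (EuclideanSpace ℂ (Fin d)) (orbitProj G (σ w.1)) (u (σ w.1)
        (pullEnd u h (σ w.1) (frameMatrixInv (φ i) u (σ w.1) ((φ i) w).2)))) w₀ :=
    ContinuousAt.comp (f := fun w : TotalSpace (EuclideanSpace ℂ (Fin d)) E =>
        (σ w.1, pullEnd u h (σ w.1) (frameMatrixInv (φ i) u (σ w.1) ((φ i) w).2)))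
      (continuous_frame hp hφ hu).continuousAt
      (hσw.prodMk (ContinuousAt.clm_apply
        (ContinuousAt.comp (f := fun w : TotalSpace (EuclideanSpace ℂ (Fin d)) E => σ w.1)
          hh.continuousAt hσw) hcoord))
  refine htot.congr ?_
  filter_upwards [hproj.eventually hσp,
    hσw'.eventually (orbitProj_eventually_mem hp (φ i).open_baseSet hi)] with w hw hw'
  obtain ⟨y, v⟩ := w
  change orbitProj G (σ y) = y at hw
  change orbitProj G (σ y) ∈ (φ i).baseSet at hw'
  change TotalSpace.mk' (EuclideanSpace ℂ (Fin d)) (orbitProj G (σ y)) (u (σ y)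
        (pullEnd u h (σ y) (frameMatrixInv (φ i) u (σ y) ((φ i) ⟨y, v⟩).2))) =
    TotalSpace.mk' (EuclideanSpace ℂ (Fin d)) y (h y v)
  generalize σ y = x' at hw hw'
  subst hw
  have h3 := frameMatrix_apply (φ i) u hw' ((u x').symm v)
  rw [LinearIsometryEquiv.apply_symm_apply] at h3
  rw [← h3, frameMatrixInv_frameMatrix _ _ hw', pullEnd_apply]
  simp

end FrameContinuity

/-! ### Uniform estimates from compactness of the base -/

section Compactness

variable {G Y : Type*} [Group G] [MetricSpace Y] [MulAction G Y]

theorem exists_isCompact_orbitProj [LocallyCompactSpace Y] [CompactSpace (OrbitSpace G Y)]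
    (hp : IsQuotientCoveringMap (orbitProj G : Y → OrbitSpace G Y) G) :
    ∃ K : Set Y, IsCompact K ∧ ∀ x : Y, ∃ g : G, ∃ k ∈ K, x = g • k := by
  have key : ∃ K : Set Y, IsCompact K ∧ (Set.univ : Set (OrbitSpace G Y)) ⊆ orbitProj G '' K := by
    refine isCompact_univ.induction_on (p := fun s : Set (OrbitSpace G Y) =>
      ∃ K : Set Y, IsCompact K ∧ s ⊆ orbitProj G '' K) ⟨∅, isCompact_empty, by simp⟩ ?_ ?_ ?_
    · rintro s t hst ⟨K, hK, hsK⟩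
      exact ⟨K, hK, hst.trans hsK⟩
    · rintro s t ⟨K, hK, hsK⟩ ⟨K', hK', htK⟩
      refine ⟨K ∪ K', hK.union hK', ?_⟩
      rw [Set.image_union]
      exact Set.union_subset_union hsK htK
    · intro y _
      obtain ⟨x, rfl⟩ := orbitProj_surjective y
      obtain ⟨K, hK, hxK⟩ := exists_compact_mem_nhds x
      exact ⟨orbitProj G '' K,
        mem_nhdsWithin_of_mem_nhds (hp.isOpenQuotientMap.isOpenMap.image_mem_nhds hxK), K, hK,
        le_rfl⟩
  obtain ⟨K, hK, hs⟩ := key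
  refine ⟨K, hK, fun x => ?_⟩
  obtain ⟨k, hk, hkx⟩ := hs (Set.mem_univ (orbitProj G x))
  obtain ⟨g, hg⟩ := hp.apply_eq_iff_mem_orbit.mp hkx.symm
  exact ⟨g, k, hk, hg.symm⟩

/-- A relation with a constant which holds near every point of a compact set holds with one
constant for all pairs of points at a distance below some `δ`. -/
theorem IsCompact.exists_uniform_radius {K : Set Y} (hK : IsCompact K) {Q : ℝ → Y → Y → Prop}
    (hmono : ∀ C C' x y, C ≤ C' → Q C x y → Q C' x y)
    (hloc : ∀ x₀ ∈ K, ∃ C, ∃ r > 0, ∀ x ∈ Metric.ball x₀ r, ∀ y ∈ Metric.ball x₀ r, Q C x y) :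
    ∃ C, ∃ δ > 0, ∀ x ∈ K, ∀ y, dist x y < δ → Q C x y := by
  refine hK.induction_on (p := fun s : Set Y =>
    ∃ C, ∃ δ > 0, ∀ x ∈ s, ∀ y, dist x y < δ → Q C x y) ⟨0, 1, one_pos, by simp⟩ ?_ ?_ ?_
  · rintro s t hst ⟨C, δ, hδ, h⟩
    exact ⟨C, δ, hδ, fun x hx => h x (hst hx)⟩
  · rintro s t ⟨C, δ, hδ, h⟩ ⟨C', δ', hδ', h'⟩
    refine ⟨max C C', min δ δ', lt_min hδ hδ', ?_⟩
    rintro x (hx | hx) y hxy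
    · exact hmono _ _ _ _ (le_max_left _ _) (h x hx y (hxy.trans_le (min_le_left _ _)))
    · exact hmono _ _ _ _ (le_max_right _ _) (h' x hx y (hxy.trans_le (min_le_right _ _)))
  · intro x₀ hx₀
    obtain ⟨C, r, hr, h⟩ := hloc x₀ hx₀
    refine ⟨Metric.ball x₀ (r / 2), mem_nhdsWithin_of_mem_nhds (Metric.ball_mem_nhds _ (by
      positivity)), C, r / 2, by positivity, fun x hx y hxy => ?_⟩
    rw [Metric.mem_ball] at hx
    refine h x (by rw [Metric.mem_ball]; linarith) y ?_
    rw [Metric.mem_ball]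
    linarith [dist_triangle_left y x₀ x]

/-- A continuous function whose norm is constant on orbits is bounded. -/
theorem exists_norm_le_of_invariant {F : Type*} [NormedAddCommGroup F] {K : Set Y}
    (hK : IsCompact K) (hGK : ∀ x : Y, ∃ g : G, ∃ k ∈ K, x = g • k) {f : Y → F}
    (hf : Continuous f) (hinv : ∀ (g : G) x, ‖f (g • x)‖ = ‖f x‖) :
    ∃ B, 0 ≤ B ∧ ∀ x, ‖f x‖ ≤ B := by
  obtain ⟨B, hB⟩ := hK.exists_bound_of_continuousOn hf.continuousOn
  refine ⟨max B 0, le_max_right _ _, fun x => ?_⟩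
  obtain ⟨g, k, hk, rfl⟩ := hGK x
  rw [hinv]
  exact (hB k hk).trans (le_max_left _ _)

/-- Deck transformations other than the identity move all points by at least some `δ`. -/
theorem exists_injectivity_radius [IsIsometricSMul G Y]
    (hp : IsQuotientCoveringMap (orbitProj G : Y → OrbitSpace G Y) G) {K : Set Y}
    (hK : IsCompact K) (hGK : ∀ x : Y, ∃ g : G, ∃ k ∈ K, x = g • k) :
    ∃ δ > 0, ∀ (x : Y) (g : G), dist x (g • x) < δ → g = 1 := by
  obtain ⟨_, δ, hδ, h⟩ := hK.exists_uniform_radius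
    (Q := fun _ x y => ∀ g : G, y = g • x → g = 1) (fun _ _ _ _ _ h => h) (fun x₀ _ => by
      obtain ⟨U, hU, hUd⟩ := hp.disjoint x₀
      obtain ⟨r, hr, hrU⟩ := Metric.mem_nhds_iff.mp hU
      refine ⟨0, r, hr, fun x hx y hy g hg => hUd g ⟨y, ⟨x, hrU hx, hg.symm⟩, hrU hy⟩⟩)
  refine ⟨δ, hδ, fun x g hg => ?_⟩
  obtain ⟨a, k, hk, rfl⟩ := hGK x
  have h1 : g • a • k = a • (a⁻¹ * g * a) • k := by simp [smul_smul, mul_assoc]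
  rw [h1, dist_smul] at hg
  have h2 := h k hk _ hg (a⁻¹ * g * a) rfl
  have h3 : g = a * (a⁻¹ * g * a) * a⁻¹ := by group
  rw [h3, h2]; group

variable {d : ℕ} {E : OrbitSpace G Y → Type*}
  [∀ y, NormedAddCommGroup (E y)] [∀ y, InnerProductSpace ℂ (E y)]

section Lipschitz

variable [TopologicalSpace (TotalSpace (EuclideanSpace ℂ (Fin d)) E)]
  [FiberBundle (EuclideanSpace ℂ (Fin d)) E]
  {ι : Type*} {φ : ι → Trivialization (EuclideanSpace ℂ (Fin d))
      (TotalSpace.proj : TotalSpace (EuclideanSpace ℂ (Fin d)) E → OrbitSpace G Y)}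
    [∀ i, (φ i).IsLinear ℂ]
  {u : ∀ x : Y, EuclideanSpace ℂ (Fin d) ≃ₗᵢ[ℂ] E (orbitProj G x)}

theorem frameMatrixInv_smul (e : Trivialization (EuclideanSpace ℂ (Fin d))
      (TotalSpace.proj : TotalSpace (EuclideanSpace ℂ (Fin d)) E → OrbitSpace G Y))
    [e.IsLinear ℂ] {x : Y} (hx : orbitProj G x ∈ e.baseSet) (g : G) (v) :
    frameMatrixInv e u (g • x) v = deckChange u g x (frameMatrixInv e u x v) := by
  have hgx : orbitProj G (g • x) ∈ e.baseSet := by rwa [orbitProj_smul]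
  rw [← frameMatrixInv_frameMatrix e u hgx (deckChange u g x _), deckChange,
    frameMatrix_frameChange, frameMatrix_frameMatrixInv e u hx]

/-- The deck changes of frame are Lipschitz, with one constant for all deck transformations: near a
point they are `F(gx)⁻¹ F(x)` for the Lipschitz frame matrices `F` of a single trivialization, and
the norm of `F(gx)⁻¹` does not depend on `g`. -/
theorem exists_deckChange_lipschitz [IsIsometricSMul G Y]
    (hp : IsQuotientCoveringMap (orbitProj G : Y → OrbitSpace G Y) G)
    (hφ : IsLipschitzTrivializingSystem φ) (hu : IsLipschitzFrame φ u) {K : Set Y}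
    (hK : IsCompact K) (hGK : ∀ x : Y, ∃ g : G, ∃ k ∈ K, x = g • k) :
    ∃ Λ, 0 ≤ Λ ∧ ∀ (g : G) x y, ‖deckChange u g x - deckChange u g y‖ ≤ Λ * dist x y := by
  obtain ⟨C, δ, hδ, hC⟩ := hK.exists_uniform_radius
    (Q := fun C x y => ∀ g : G, ‖deckChange u g x - deckChange u g y‖ ≤ C * dist x y)
    (fun C C' x y hCC h g => (h g).trans (by gcongr)) (fun x₀ _ => by
      obtain ⟨i, hi⟩ := hφ.cover (orbitProj G x₀)
      obtain ⟨L, hL⟩ := hu i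
      have hev := orbitProj_eventually_mem hp (φ i).open_baseSet hi
      have hinv := continuousAt_frameMatrixInv (φ i) hev (hu.continuousAt hp hi)
      have hbd : ∀ᶠ x in 𝓝 x₀, ‖frameMatrixInv (φ i) u x‖ < ‖frameMatrixInv (φ i) u x₀‖ + 1 :=
        hinv.norm.eventually (gt_mem_nhds (by linarith))
      obtain ⟨r, hr, hball⟩ := Metric.eventually_nhds_iff_ball.mp (hev.and hbd)
      set B := ‖frameMatrixInv (φ i) u x₀‖ + 1 with hB
      have hB0 : 0 ≤ B := by positivity
      refine ⟨2 * B * L, r, hr, fun x hx y hy g => ?_⟩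
      have hxb := (hball x hx).1
      have hyb := (hball y hy).1
      have hgxb : orbitProj G (g • x) ∈ (φ i).baseSet := by rwa [orbitProj_smul]
      have hgyb : orbitProj G (g • y) ∈ (φ i).baseSet := by rwa [orbitProj_smul]
      have hLip : ∀ x y, orbitProj G x ∈ (φ i).baseSet → orbitProj G y ∈ (φ i).baseSet →
          ‖frameMatrix (φ i) u x - frameMatrix (φ i) u y‖ ≤ L * dist x y := by
        intro x y hx hy
        rw [← dist_eq_norm]
        exact hL.dist_le_mul x hx y hy
      refine ContinuousLinearMap.opNorm_le_bound _ (by positivity) fun v => ?_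
      have hdec : (deckChange u g x - deckChange u g y) v = frameMatrixInv (φ i) u (g • x)
          ((frameMatrix (φ i) u x - frameMatrix (φ i) u y) v +
            (frameMatrix (φ i) u (g • y) - frameMatrix (φ i) u (g • x)) (deckChange u g y v)) := by
        have e1 : frameMatrix (φ i) u (g • x) (deckChange u g x v) = frameMatrix (φ i) u x v :=
          frameMatrix_frameChange _ _ _ _
        have e2 : frameMatrix (φ i) u (g • y) (deckChange u g y v) = frameMatrix (φ i) u y v :=
          frameMatrix_frameChange _ _ _ _
        simp only [sub_apply, e2]
        rw [sub_add_sub_cancel, map_sub, ← e1, frameMatrixInv_frameMatrix _ _ hgxb,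
          frameMatrixInv_frameMatrix _ _ hgxb]
      rw [hdec, frameMatrixInv_smul _ hxb, norm_deckChange_apply]
      calc _ ≤ B * (L * dist x y * ‖v‖ + L * dist x y * ‖v‖) := by
            refine ((frameMatrixInv (φ i) u x).le_of_opNorm_le (hball x hx).2.le _).trans ?_
            gcongr
            refine (norm_add_le _ _).trans (add_le_add ?_ ?_)
            · exact ContinuousLinearMap.le_of_opNorm_le _ (hLip x y hxb hyb) v
            · refine (ContinuousLinearMap.le_of_opNorm_le _ (hLip _ _ hgyb hgxb) _).trans ?_
              rw [norm_deckChange_apply, dist_smul, dist_comm]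
        _ = _ := by ring)
  set Λ := max (max C (2 / δ)) 0 with hΛ
  have hΛ0 : 0 ≤ Λ := le_max_right _ _
  have hbase : ∀ (g : G), ∀ x ∈ K, ∀ y,
      ‖deckChange u g x - deckChange u g y‖ ≤ Λ * dist x y := by
    intro g x hx y
    rcases lt_or_ge (dist x y) δ with h | h
    · refine (hC x hx y h g).trans ?_
      gcongr
      exact (le_max_left _ _).trans (le_max_left _ _)
    · calc _ ≤ 1 + 1 := (norm_sub_le _ _).trans
            (add_le_add (norm_deckChange_le u _ _) (norm_deckChange_le u _ _))
        _ = 2 / δ * δ := by field_simp; norm_num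
        _ ≤ Λ * dist x y := by
            gcongr
            exact (le_max_right _ _).trans (le_max_left _ _)
  refine ⟨2 * Λ, by positivity, fun g x y => ?_⟩
  obtain ⟨a, k, hk, rfl⟩ := hGK x
  obtain ⟨l, rfl⟩ : ∃ l, y = a • l := ⟨a⁻¹ • y, by simp⟩
  rw [dist_smul]
  refine ContinuousLinearMap.opNorm_le_bound _ (by positivity) fun v => ?_
  -- with `w` the coordinates at `k` of the vector `v` at `a • k`, both terms are moved to `k`, `l`
  set w := deckChange u a⁻¹ (a • k) v with hw
  have hv : v = deckChange u a k w := by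
    have := deckChange_inv_apply u a⁻¹ (a • k) v
    rw [inv_inv] at this
    rw [hw]
    simpa using this.symm
  have hwn : ‖w‖ = ‖v‖ := norm_deckChange_apply u _ _ _
  have hdec : (deckChange u g (a • k) - deckChange u g (a • l)) v =
      (deckChange u (g * a) k - deckChange u (g * a) l) w -
        deckChange u g (a • l) ((deckChange u a k - deckChange u a l) w) := by
    simp only [sub_apply, map_sub, deckChange_mul_apply]
    rw [← hv]
    abel
  rw [hdec]
  calc _ ≤ Λ * dist k l * ‖w‖ + Λ * dist k l * ‖w‖ := by
        refine (norm_sub_le _ _).trans (add_le_add ?_ ?_)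
        · exact ContinuousLinearMap.le_of_opNorm_le _ (hbase _ k hk l) w
        · rw [norm_deckChange_apply]
          exact ContinuousLinearMap.le_of_opNorm_le _ (hbase _ k hk l) w
    _ = _ := by rw [hwn]; ring

end Lipschitz

variable {u : ∀ x : Y, EuclideanSpace ℂ (Fin d) ≃ₗᵢ[ℂ] E (orbitProj G x)}

theorem uniformContinuous_pullEnd [IsIsometricSMul G Y] {K : Set Y}
    (hK : IsCompact K) (hGK : ∀ x : Y, ∃ g : G, ∃ k ∈ K, x = g • k)
    {Λ : ℝ} (hΛ0 : 0 ≤ Λ)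
    (hΛ : ∀ (g : G) x y, ‖deckChange u g x - deckChange u g y‖ ≤ Λ * dist x y)
    {h : ∀ y, E y →L[ℂ] E y} (hc : Continuous (pullEnd u h)) :
    UniformContinuous (pullEnd u h) := by
  obtain ⟨B, hB0, hB⟩ := exists_norm_le_of_invariant hK hGK hc (fun g x => by
    rw [norm_pullEnd, norm_pullEnd, orbitProj_smul])
  rw [Metric.uniformContinuous_iff]
  intro ε hε
  obtain ⟨_, δ, hδ, hδ'⟩ := hK.exists_uniform_radius
    (Q := fun _ x y => ‖pullEnd u h x - pullEnd u h y‖ ≤ ε / 2)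
    (fun _ _ _ _ _ h => h) (fun x₀ _ => by
      obtain ⟨r, hr, hball⟩ := Metric.continuousAt_iff.mp (hc.continuousAt (x := x₀)) (ε / 4)
        (by positivity)
      refine ⟨0, r, hr, fun x hx y hy => ?_⟩
      rw [← dist_eq_norm]
      linarith [hball hx, hball hy, dist_triangle_right (pullEnd u h x) (pullEnd u h y)
        (pullEnd u h x₀)])
  refine ⟨min δ (ε / 2 / (2 * B * Λ + 1)), by positivity, fun x y hxy => ?_⟩
  obtain ⟨a, k, hk, rfl⟩ := hGK x
  obtain ⟨l, rfl⟩ : ∃ l, y = a • l := ⟨a⁻¹ • y, by simp⟩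
  rw [dist_smul] at hxy
  have h1 := hδ' k hk l (hxy.trans_le (min_le_left _ _))
  have h2 : dist k l * (2 * B * Λ + 1) < ε / 2 :=
    (lt_div_iff₀ (by positivity)).mp (hxy.trans_le (min_le_right _ _))
  rw [dist_eq_norm]
  refine lt_of_le_of_lt (b := ε / 2 + 2 * B * Λ * dist k l) ?_
    (by linarith [dist_nonneg (x := k) (y := l)])
  refine ContinuousLinearMap.opNorm_le_bound _ (by positivity) fun v => ?_
  set w := deckChange u a⁻¹ (a • k) v with hw
  have hv : v = deckChange u a k w := by
    have := deckChange_inv_apply u a⁻¹ (a • k) v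
    rw [inv_inv] at this
    rw [hw]
    simpa using this.symm
  have hwn : ‖w‖ = ‖v‖ := norm_deckChange_apply u _ _ _
  set Q := deckChange u a k - deckChange u a l with hQ
  have hQn : ‖Q‖ ≤ Λ * dist k l := hΛ a k l
  have e1 : pullEnd u h (a • k) v = deckChange u a k (pullEnd u h k w) := by
    rw [hv]; exact pullEnd_frameChange u h _ w
  have e2 : pullEnd u h (a • l) v =
      deckChange u a l (pullEnd u h l w) + pullEnd u h (a • l) (Q w) := by
    have : pullEnd u h (a • l) (deckChange u a l w) = deckChange u a l (pullEnd u h l w) :=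
      pullEnd_frameChange u h _ w
    rw [← this, ← map_add, hQ, sub_apply, ← hv]
    congr 1; abel
  have hdec : (pullEnd u h (a • k) - pullEnd u h (a • l)) v =
      deckChange u a l ((pullEnd u h k - pullEnd u h l) w) + Q (pullEnd u h k w) -
        pullEnd u h (a • l) (Q w) := by
    rw [sub_apply, e1, e2, hQ]
    simp only [sub_apply, map_sub]
    abel
  rw [hdec]
  calc _ ≤ ε / 2 * ‖w‖ + Λ * dist k l * (B * ‖w‖) + B * (Λ * dist k l * ‖w‖) := by
        refine (norm_sub_le _ _).trans (add_le_add ((norm_add_le _ _).trans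
          (add_le_add ?_ ?_)) ?_)
        · rw [norm_deckChange_apply]
          exact ContinuousLinearMap.le_of_opNorm_le _ h1 w
        · refine (Q.le_of_opNorm_le hQn _).trans ?_
          gcongr
          exact ContinuousLinearMap.le_of_opNorm_le _ (hB k) w
        · refine (ContinuousLinearMap.le_of_opNorm_le _ (hB _) _).trans ?_
          gcongr
          exact Q.le_of_opNorm_le hQn w
    _ = _ := by rw [hwn]; ring

end Compactness

/-! ### Lipschitz sections and the norm of `L` -/

section LipschitzSections

section Norms

variable {G Y : Type*} [Group G] [MetricSpace Y] [MulAction G Y] {d : ℕ}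
  {E : OrbitSpace G Y → Type*} [∀ y, NormedAddCommGroup (E y)] [∀ y, InnerProductSpace ℂ (E y)]
  {u : ∀ x : Y, EuclideanSpace ℂ (Fin d) ≃ₗᵢ[ℂ] E (orbitProj G x)}

theorem lipNorm_le {s : ∀ y, E y} {A B : ℝ} (hA0 : 0 ≤ A) (hB0 : 0 ≤ B)
    (hA : ∀ x, ‖pullSection u s x‖ ≤ A)
    (hB : ∀ x y, ‖pullSection u s x - pullSection u s y‖ ≤ B * dist x y) :
    lipNorm u s ≤ ENNReal.ofReal (A + B) := by
  rw [ENNReal.ofReal_add hA0 hB0]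
  refine add_le_add (iSup_le fun y => ?_) (iSup_le fun x => iSup_le fun y => ?_)
  · obtain ⟨x, rfl⟩ := orbitProj_surjective y
    rw [← ofReal_norm, ← norm_pullSection u]
    exact ENNReal.ofReal_le_ofReal (hA x)
  · refine ENNReal.div_le_of_le_mul ?_
    rw [← ofReal_norm, edist_dist, ← ENNReal.ofReal_mul hB0]
    exact ENNReal.ofReal_le_ofReal (hB x y)

theorem norm_pullSection_le_of_lipNorm_le {s : ∀ y, E y} (x : Y) {N : ℝ} (hN0 : 0 ≤ N)
    (h : lipNorm u s ≤ ENNReal.ofReal N) : ‖pullSection u s x‖ ≤ N := by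
  rw [norm_pullSection, ← ENNReal.ofReal_le_ofReal_iff hN0, ofReal_norm]
  exact ((le_iSup (fun y => ‖s y‖ₑ) (orbitProj G x)).trans le_self_add).trans h

theorem exists_bounds_of_lipNorm_le_one {s : ∀ y, E y} (h : lipNorm u s ≤ 1) :
    ∃ α β : ℝ, 0 ≤ α ∧ 0 ≤ β ∧ α + β ≤ 1 ∧ (∀ x, ‖pullSection u s x‖ ≤ α) ∧
      ∀ x y, ‖pullSection u s x - pullSection u s y‖ ≤ β * dist x y := by
  rw [lipNorm] at h
  set α := ⨆ y, ‖s y‖ₑ with hα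
  set β := ⨆ (x : Y) (y : Y), ‖pullSection u s x - pullSection u s y‖ₑ / edist x y with hβ
  have hα1 : α ≠ ⊤ := ne_top_of_le_ne_top ENNReal.one_ne_top (le_self_add.trans h)
  have hβ1 : β ≠ ⊤ := ne_top_of_le_ne_top ENNReal.one_ne_top (le_add_self.trans h)
  refine ⟨α.toReal, β.toReal, ENNReal.toReal_nonneg, ENNReal.toReal_nonneg, ?_, fun x => ?_,
    fun x y => ?_⟩
  · rw [← ENNReal.toReal_add hα1 hβ1, ← ENNReal.toReal_one]
    exact ENNReal.toReal_mono ENNReal.one_ne_top h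
  · rw [norm_pullSection, ← toReal_enorm]
    exact ENNReal.toReal_mono hα1 (le_iSup (fun y => ‖s y‖ₑ) (orbitProj G x))
  · rcases eq_or_ne x y with rfl | hxy
    · simp
    have h1 : ‖pullSection u s x - pullSection u s y‖ₑ / edist x y ≤ β :=
      le_iSup₂ (f := fun x y => ‖pullSection u s x - pullSection u s y‖ₑ / edist x y) x y
    rw [ENNReal.div_le_iff (edist_pos.mpr hxy).ne' (edist_ne_top x y)] at h1
    have h2 := ENNReal.toReal_mono (ENNReal.mul_ne_top hβ1 (edist_ne_top x y)) h1
    rwa [toReal_enorm, ENNReal.toReal_mul, edist_dist, ENNReal.toReal_ofReal dist_nonneg] at h2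

theorem norm_apply_sub_apply_le {H : Type*} [NormedAddCommGroup H] [NormedSpace ℂ H]
    {A A' : H →L[ℂ] H} {v v' : H} {a b α β t : ℝ} (hA : ‖A‖ ≤ a) (hA' : ‖A - A'‖ ≤ b * t)
    (hv : ‖v'‖ ≤ α) (hv' : ‖v - v'‖ ≤ β * t) :
    ‖A v - A' v'‖ ≤ (a * β + b * α) * t := by
  have h : A v - A' v' = A (v - v') + (A - A') v' := by simp
  rw [h]
  calc _ ≤ a * (β * t) + b * t * α := by
        refine (norm_add_le _ _).trans (add_le_add ?_ ?_)
        · refine (A.le_of_opNorm_le hA _).trans ?_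
          have := (norm_nonneg _).trans hA
          gcongr
        · refine ((A - A').le_of_opNorm_le hA' _).trans ?_
          have := (norm_nonneg _).trans hA'
          gcongr
    _ = _ := by ring

variable [TopologicalSpace (TotalSpace (EuclideanSpace ℂ (Fin d)) E)]

/-- An endomorphism whose pull-back is Lipschitz acts boundedly on the Lipschitz sections. -/
theorem lipOpNorm_le {h : ∀ y, E y →L[ℂ] E y} {A B : ℝ} (hA0 : 0 ≤ A) (hB0 : 0 ≤ B)
    (hA : ∀ x, ‖pullEnd u h x‖ ≤ A)
    (hB : ∀ x y, ‖pullEnd u h x - pullEnd u h y‖ ≤ B * dist x y) :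
    lipOpNorm u h ≤ ENNReal.ofReal (A + B) := by
  refine iSup_le fun s => iSup_le fun _ => iSup_le fun hs1 => ?_
  obtain ⟨α, β, hα0, hβ0, hαβ, hα, hβ⟩ := exists_bounds_of_lipNorm_le_one hs1
  have h1 := lipNorm_le (u := u) (s := fun y => h y (s y)) (A := A * α) (B := A * β + B * α)
    (by positivity) (by positivity)
    (fun x => by
      rw [pullSection_apply_end]
      exact (ContinuousLinearMap.le_of_opNorm_le _ (hA x) _).trans (by gcongr; exact hα x))
    (fun x y => by
      rw [pullSection_apply_end, pullSection_apply_end]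
      exact norm_apply_sub_apply_le (hA x) (hB x y) (hα y) (hβ x y))
  refine h1.trans (ENNReal.ofReal_le_ofReal ?_)
  nlinarith

/-- If every vector extends to a Lipschitz section of comparable norm, then the norm of `L`
dominates the sup-norm. -/
theorem norm_pullEnd_le_of_lipOpNorm_le {C N : ℝ} (hC : 0 < C) (hN0 : 0 ≤ N)
    (hsec : ∀ (x : Y) (v : EuclideanSpace ℂ (Fin d)), ∃ s ∈ lipSections u,
      pullSection u s x = v ∧ lipNorm u s ≤ ENNReal.ofReal (C * ‖v‖))
    {h : ∀ y, E y →L[ℂ] E y} (hN : lipOpNorm u h ≤ ENNReal.ofReal N) (x : Y) :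
    ‖pullEnd u h x‖ ≤ C * N := by
  refine ContinuousLinearMap.opNorm_le_bound _ (by positivity) fun v => ?_
  rcases eq_or_ne v 0 with rfl | hv
  · simp
  have hv0 : 0 < ‖v‖ := norm_pos_iff.mpr hv
  set c : ℂ := ((C * ‖v‖ : ℝ) : ℂ)⁻¹ with hc
  have hcn : ‖c‖ = (C * ‖v‖)⁻¹ := by
    rw [hc, norm_inv, Complex.norm_real, Real.norm_of_nonneg (by positivity)]
  obtain ⟨s, hs, hsx, hsn⟩ := hsec x (c • v)
  have h1 : lipNorm u s ≤ 1 := by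
    refine hsn.trans ?_
    rw [norm_smul, hcn, ← ENNReal.ofReal_one]
    refine ENNReal.ofReal_le_ofReal (le_of_eq ?_)
    field_simp
  have h2 : lipNorm u (fun y => h y (s y)) ≤ ENNReal.ofReal N :=
    le_trans (le_iSup₂_of_le s hs
    (le_iSup (fun _ : lipNorm u s ≤ 1 => lipNorm u (fun y => h y (s y))) h1)) hN
  have h3 := norm_pullSection_le_of_lipNorm_le x hN0 h2
  rw [pullSection_apply_end, hsx, map_smul, norm_smul, hcn] at h3
  rw [inv_mul_le_iff₀ (by positivity)] at h3
  linarith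

end Norms

section BumpSections

variable {G Y : Type*} [Group G] [MetricSpace Y] [MulAction G Y] {d : ℕ}
  {E : OrbitSpace G Y → Type*} [∀ y, NormedAddCommGroup (E y)] [∀ y, InnerProductSpace ℂ (E y)]
  {u : ∀ x : Y, EuclideanSpace ℂ (Fin d) ≃ₗᵢ[ℂ] E (orbitProj G x)}

/-- The cut-off of radius `δ` around `g x₀`, times the vector `v` given at `x₀` and carried along
the deck transformation `g`. -/
noncomputable def bumpTerm
    (u : ∀ x : Y, EuclideanSpace ℂ (Fin d) ≃ₗᵢ[ℂ] E (orbitProj G x)) (δ : ℝ) (x₀ : Y)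
    (v : EuclideanSpace ℂ (Fin d)) (g : G) (x : Y) : EuclideanSpace ℂ (Fin d) :=
  ((max 0 (1 - dist x (g • x₀) / δ) : ℝ) : ℂ) • deckChange u g (g⁻¹ • x) v

theorem bumpTerm_eq_zero {δ : ℝ} (hδ : 0 < δ) {x₀ : Y} (v : EuclideanSpace ℂ (Fin d)) {g : G}
    {x : Y} (h : δ ≤ dist x (g • x₀)) : bumpTerm u δ x₀ v g x = 0 := by
  have : 1 - dist x (g • x₀) / δ ≤ 0 := by
    rw [sub_nonpos, le_div_iff₀ hδ]; linarith
  simp [bumpTerm, max_eq_left this]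

theorem cutoff_le_one {δ : ℝ} (hδ : 0 < δ) (x y : Y) : max 0 (1 - dist x y / δ) ≤ 1 :=
  max_le zero_le_one (by have : 0 ≤ dist x y / δ := by positivity
                         linarith)

theorem norm_bumpTerm_le {δ : ℝ} (hδ : 0 < δ) (x₀ : Y) (v : EuclideanSpace ℂ (Fin d)) (g : G)
    (x : Y) : ‖bumpTerm u δ x₀ v g x‖ ≤ ‖v‖ := by
  rw [bumpTerm, norm_smul, norm_deckChange_apply, Complex.norm_real,
    Real.norm_of_nonneg (le_max_left _ _)]
  exact mul_le_of_le_one_left (norm_nonneg _) (cutoff_le_one hδ _ _)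

theorem bumpTerm_smul [IsIsometricSMul G Y] (δ : ℝ) (x₀ : Y) (v : EuclideanSpace ℂ (Fin d))
    (a g : G) (x : Y) :
    bumpTerm u δ x₀ v (a * g) (a • x) = deckChange u a x (bumpTerm u δ x₀ v g x) := by
  rw [bumpTerm, bumpTerm, mul_smul, dist_smul, map_smul]
  congr 1
  rw [mul_inv_rev, mul_smul, inv_smul_smul, deckChange_mul_apply, smul_inv_smul]

theorem norm_bumpTerm_sub_le [IsIsometricSMul G Y] {Λ : ℝ}
    (hΛ : ∀ (g : G) x y, ‖deckChange u g x - deckChange u g y‖ ≤ Λ * dist x y) {δ : ℝ}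
    (hδ : 0 < δ) (x₀ : Y) (v : EuclideanSpace ℂ (Fin d)) (g : G) (x y : Y) :
    ‖bumpTerm u δ x₀ v g x - bumpTerm u δ x₀ v g y‖ ≤ (Λ + 1 / δ) * ‖v‖ * dist x y := by
  set a : ℝ := max 0 (1 - dist x (g • x₀) / δ) with ha
  set b : ℝ := max 0 (1 - dist y (g • x₀) / δ) with hb
  have ha0 : 0 ≤ a := le_max_left _ _
  have ha1 : a ≤ 1 := cutoff_le_one hδ _ _
  have hab : |a - b| ≤ 1 / δ * dist x y := by
    refine (abs_max_sub_max_le_max _ _ _ _).trans ?_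
    rw [sub_self, abs_zero, max_eq_right (abs_nonneg _), sub_sub_sub_cancel_left, ← sub_div,
      abs_div, abs_of_pos hδ, one_div, inv_mul_eq_div, dist_comm x y]
    gcongr
    exact abs_dist_sub_le y x (g • x₀)
  have hdec : bumpTerm u δ x₀ v g x - bumpTerm u δ x₀ v g y =
      (a : ℂ) • (deckChange u g (g⁻¹ • x) - deckChange u g (g⁻¹ • y)) v +
        ((a - b : ℝ) : ℂ) • deckChange u g (g⁻¹ • y) v := by
    rw [bumpTerm, bumpTerm, ← ha, ← hb, sub_apply, smul_sub, Complex.ofReal_sub, sub_smul]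
    abel
  have hΛ' := hΛ g (g⁻¹ • x) (g⁻¹ • y)
  rw [dist_smul] at hΛ'
  rw [hdec]
  calc _ ≤ 1 * (Λ * dist x y * ‖v‖) + 1 / δ * dist x y * ‖v‖ := by
        refine (norm_add_le _ _).trans (add_le_add ?_ ?_)
        · rw [norm_smul, Complex.norm_real, Real.norm_of_nonneg ha0]
          gcongr
          exact ContinuousLinearMap.le_of_opNorm_le _ hΛ' v
        · rw [norm_smul, norm_deckChange_apply, Complex.norm_real, Real.norm_eq_abs]
          gcongr
    _ = _ := by ring

variable [TopologicalSpace (TotalSpace (EuclideanSpace ℂ (Fin d)) E)]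
  [FiberBundle (EuclideanSpace ℂ (Fin d)) E]
  {ι : Type*} {φ : ι → Trivialization (EuclideanSpace ℂ (Fin d))
      (TotalSpace.proj : TotalSpace (EuclideanSpace ℂ (Fin d)) E → OrbitSpace G Y)}
    [∀ i, (φ i).IsLinear ℂ]

/-- Every vector extends to a Lipschitz section of comparable norm: below half the injectivity
radius at most one of the cut-offs around the translates of a point is nonzero at a given point, so
their sum is a well-defined Lipschitz function. -/
theorem exists_lipSection_eq [IsIsometricSMul G Y]
    (hp : IsQuotientCoveringMap (orbitProj G : Y → OrbitSpace G Y) G)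
    (hφ : IsLipschitzTrivializingSystem φ) (hu : IsLipschitzFrame φ u)
    {Λ : ℝ} (hΛ0 : 0 ≤ Λ)
    (hΛ : ∀ (g : G) x y, ‖deckChange u g x - deckChange u g y‖ ≤ Λ * dist x y)
    {δ : ℝ} (hδ : 0 < δ) (hinj : ∀ (x : Y) (g : G), dist x (g • x) < 2 * δ → g = 1)
    (x₀ : Y) (v : EuclideanSpace ℂ (Fin d)) :
    ∃ s ∈ lipSections u, pullSection u s x₀ = v ∧
      lipNorm u s ≤ ENNReal.ofReal ((1 + 2 * (Λ + 1 / δ)) * ‖v‖) := by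
  set t : G → Y → EuclideanSpace ℂ (Fin d) := bumpTerm u δ x₀ v with ht
  have huniq : ∀ x (g g' : G), dist x (g • x₀) < δ → dist x (g' • x₀) < δ → g' = g := by
    intro x g g' h h'
    have h1 : dist x₀ ((g⁻¹ * g') • x₀) < 2 * δ := by
      rw [← dist_smul g, smul_smul, mul_inv_cancel_left]
      linarith [dist_triangle_left (g • x₀) (g' • x₀) x]
    exact (inv_mul_eq_one.mp (hinj x₀ _ h1)).symm
  set f : Y → EuclideanSpace ℂ (Fin d) := fun x => ∑ᶠ g, t g x with hf
  have hone : ∀ x g, (∀ k, k ≠ g → t k x = 0) → f x = t g x := fun x g h =>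
    finsum_eq_single (fun g => t g x) g h
  have hnear : ∀ x g, dist x (g • x₀) < δ → ∀ k, k ≠ g → t k x = 0 := by
    intro x g h k hk
    refine bumpTerm_eq_zero hδ v (not_lt.mp fun h' => hk (huniq x g k h h'))
  have hex : ∀ x, ∃ g, ∀ k, k ≠ g → t k x = 0 := by
    intro x
    by_cases h : ∃ g : G, dist x (g • x₀) < δ
    · obtain ⟨g, hg⟩ := h
      exact ⟨g, hnear x g hg⟩
    · push Not at h
      exact ⟨1, fun k _ => bumpTerm_eq_zero hδ v (h k)⟩
  have hequiv : ∀ (x x' : Y) (e : orbitProj G x = orbitProj G x'),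
      f x' = frameChange u e (f x) := by
    intro x x' e
    obtain ⟨a, ha⟩ := hp.apply_eq_iff_mem_orbit.mp e.symm
    have ha' : x' = a • x := ha.symm
    rw [frameChange_eq_deckChange u ha']
    subst ha'
    obtain ⟨g, hg⟩ := hex x
    rw [hone x g hg, hone (a • x) (a * g), ht, bumpTerm_smul]
    intro k hk
    have : k = a * (a⁻¹ * k) := by group
    rw [this, ht, bumpTerm_smul]
    have h0 : t (a⁻¹ * k) x = 0 := hg _ (fun h => hk (by rw [← h]; group))
    rw [ht] at h0
    rw [h0, map_zero]
  obtain ⟨s, hs⟩ := exists_pullSection_eq u hequiv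
  have hM0 : 0 ≤ (Λ + 1 / δ) * ‖v‖ := by positivity
  have hbd : ∀ x, ‖f x‖ ≤ ‖v‖ := by
    intro x
    obtain ⟨g, hg⟩ := hex x
    rw [hone x g hg]
    exact norm_bumpTerm_le hδ _ _ _ _
  have hlip : ∀ x y, ‖f x - f y‖ ≤ 2 * (Λ + 1 / δ) * ‖v‖ * dist x y := by
    intro x y
    obtain ⟨g, hg⟩ := hex x
    obtain ⟨g', hg'⟩ := hex y
    rw [hone x g hg, hone y g' hg']
    have h1 := norm_bumpTerm_sub_le hΛ hδ x₀ v g x y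
    have h2 := norm_bumpTerm_sub_le hΛ hδ x₀ v g' x y
    have hpos : 0 ≤ (Λ + 1 / δ) * ‖v‖ * dist x y := by positivity
    rcases eq_or_ne g g' with rfl | hne
    · linarith
    · have e1 := hg g' hne.symm
      have e2 := hg' g hne
      simp only [ht] at e1 e2 ⊢
      rw [e2, sub_zero] at h1
      rw [e1, zero_sub, norm_neg] at h2
      linarith [norm_sub_le (bumpTerm u δ x₀ v g x) (bumpTerm u δ x₀ v g' y)]
  have hLip : LipschitzWith (Real.toNNReal (2 * (Λ + 1 / δ) * ‖v‖)) (pullSection u s) := by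
    refine LipschitzWith.of_dist_le_mul fun x y => ?_
    rw [hs, dist_eq_norm, Real.coe_toNNReal _ (by positivity)]
    exact hlip x y
  refine ⟨s, ⟨continuous_section_of_pullSection hp hφ hu hLip.continuous, _, hLip⟩, ?_, ?_⟩
  · rw [hs, hone x₀ 1 (hnear x₀ 1 (by simpa using hδ)), ht, bumpTerm, one_smul, dist_self,
      zero_div, sub_zero, max_eq_right zero_le_one, Complex.ofReal_one, one_smul,
      ← frameChange_eq_deckChange u (x := (1 : G)⁻¹ • x₀) (x' := (1 : G)⁻¹ • x₀)
        (one_smul _ _).symm rfl, frameChange_self]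
  · have := lipNorm_le (u := u) (s := s) (norm_nonneg v) (B := 2 * (Λ + 1 / δ) * ‖v‖)
      (by positivity) (by rw [hs]; exact hbd) (by rw [hs]; exact hlip)
    refine this.trans (le_of_eq ?_)
    congr 1; ring

variable [VectorBundle ℂ (EuclideanSpace ℂ (Fin d)) E]

theorem mem_lipEnd_of_lipschitz {K : Set Y}
    (hp : IsQuotientCoveringMap (orbitProj G : Y → OrbitSpace G Y) G)
    (hφ : IsLipschitzTrivializingSystem φ) (hu : IsLipschitzFrame φ u)
    (hK : IsCompact K) (hGK : ∀ x : Y, ∃ g : G, ∃ k ∈ K, x = g • k)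
    {h : ∀ y, E y →L[ℂ] E y} (hh : h ∈ bundleEnd d E) {A B : ℝ} (hA0 : 0 ≤ A) (hB0 : 0 ≤ B)
    (hA : ∀ x, ‖pullEnd u h x‖ ≤ A)
    (hB : ∀ x y, ‖pullEnd u h x - pullEnd u h y‖ ≤ B * dist x y) : h ∈ lipEnd u := by
  refine ⟨hh, fun s hs => ?_, (lipOpNorm_le hA0 hB0 hA hB).trans_lt ENNReal.ofReal_lt_top⟩
  obtain ⟨_, L, hL⟩ := hs
  obtain ⟨α, hα0, hα⟩ := exists_norm_le_of_invariant hK hGK hL.continuous (fun g x => by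
    rw [norm_pullSection, norm_pullSection, orbitProj_smul])
  have hLip : LipschitzWith (Real.toNNReal (A * L + B * α))
      (pullSection u fun y => h y (s y)) := by
    refine LipschitzWith.of_dist_le_mul fun x y => ?_
    rw [dist_eq_norm, Real.coe_toNNReal _ (by positivity), pullSection_apply_end,
      pullSection_apply_end]
    refine norm_apply_sub_apply_le (hA x) (hB x y) (hα y) ?_
    rw [← dist_eq_norm]
    exact hL.dist_le_mul x y
  exact ⟨continuous_section_of_pullSection hp hφ hu hLip.continuous, _, hLip⟩

end BumpSections

end LipschitzSections

/-! ### Convergence of the Cesàro means of a transfer operator -/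

section TransferConvergence

open BoundedContinuousFunction

variable {Y H I : Type*} [NormedAddCommGroup H] [InnerProductSpace ℂ H]
  [CompleteSpace H] [Fintype I] [PseudoMetricSpace Y] {ψ : I → Y → Y} {a : I → Y → H →L[ℂ] H}

theorem continuous_weightedTransfer (hψ : ∀ i, Continuous (ψ i)) (ha : ∀ i, Continuous (a i))
    {f : Y → H →L[ℂ] H} (hf : Continuous f) : Continuous (weightedTransfer ψ a f) := by
  refine continuous_finsetSum _ fun i _ => ?_
  exact ((ContinuousLinearMap.adjoint (𝕜 := ℂ) (E := H) (F := H)).continuous.comp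
    (ha i)).clm_comp ((hf.comp (hψ i)).clm_comp (ha i))

/-- The transfer operator as a bounded operator on bounded continuous functions. -/
theorem exists_weightedTransfer_clm {C : ℝ} (hC0 : 0 ≤ C)
    (hψ : ∀ i, Continuous (ψ i)) (ha : ∀ i, Continuous (a i))
    (hw : ∀ n x v, ∑ w : Fin n → I, ‖wordWeight ψ a n w x v‖ ^ 2 ≤ C * ‖v‖ ^ 2) :
    ∃ R : (Y →ᵇ (H →L[ℂ] H)) →L[ℂ] (Y →ᵇ (H →L[ℂ] H)),
      ∀ f x, R f x = weightedTransfer ψ a f x := by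
  have hbd : ∀ (f : Y →ᵇ (H →L[ℂ] H)) x, ‖weightedTransfer ψ a f x‖ ≤ C * ‖f‖ := fun f x =>
    norm_iterate_weightedTransfer_le hC0 hw (norm_nonneg f) f.norm_coe_le_norm 1 x
  let R₀ : (Y →ᵇ (H →L[ℂ] H)) →ₗ[ℂ] (Y →ᵇ (H →L[ℂ] H)) :=
    { toFun := fun f => ofNormedAddCommGroup (weightedTransfer ψ a f)
        (continuous_weightedTransfer hψ ha f.continuous) (C * ‖f‖) (hbd f)
      map_add' := fun f g => by
        ext x v
        simp [weightedTransfer, Finset.sum_add_distrib]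
      map_smul' := fun c f => by
        ext x v
        simp [weightedTransfer, Finset.smul_sum] }
  exact ⟨R₀.mkContinuous C fun f =>
    (norm_le (by positivity)).mpr (hbd f), fun f x => rfl⟩

/-- For a transfer operator with contracting branches and Lipschitz weights the Cesàro means of a
uniformly continuous function converge uniformly, provided the function lies in an invariant
subspace whose members attain all their norms on a compact set: by the uniform modulus of
continuity and Arzelà–Ascoli they have a cluster point. -/
theorem exists_tendsto_cesaroMean_weightedTransfer [FiniteDimensional ℂ H] {θ C L : ℝ}
    (hθ0 : 0 ≤ θ) (hθ1 : θ < 1) (hC0 : 0 ≤ C) (hL : 0 ≤ L)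
    (hψ : ∀ i x y, dist (ψ i x) (ψ i y) ≤ θ * dist x y)
    (ha : ∀ i x y, ‖a i x - a i y‖ ≤ L * dist x y)
    (hw : ∀ n x v, ∑ w : Fin n → I, ‖wordWeight ψ a n w x v‖ ^ 2 ≤ C * ‖v‖ ^ 2)
    {R : (Y →ᵇ (H →L[ℂ] H)) →L[ℂ] (Y →ᵇ (H →L[ℂ] H))}
    (hR : ∀ f x, R f x = weightedTransfer ψ a f x)
    {V : Submodule ℂ (Y →ᵇ (H →L[ℂ] H))} (hRV : ∀ f ∈ V, R f ∈ V) {K : Set Y} (hK : IsCompact K)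
    (hVK : ∀ f ∈ V, ∀ x, ∃ k ∈ K, ‖f x‖ = ‖f k‖) {f : Y →ᵇ (H →L[ℂ] H)} (hf : f ∈ V)
    (hfu : UniformContinuous f) :
    ∃ g, R g = g ∧ Tendsto (fun k => cesaroMean R k f) atTop (𝓝 g) := by
  have hiter : ∀ n (f : Y →ᵇ (H →L[ℂ] H)), ⇑(R^[n] f) = (weightedTransfer ψ a)^[n] f := by
    intro n f
    exact (Function.Semiconj.iterate_right (f := fun f : Y →ᵇ (H →L[ℂ] H) => ⇑f)
      (fun f => funext (hR f)) n) f
  have hpow : ∀ n (f : Y →ᵇ (H →L[ℂ] H)), ‖R^[n] f‖ ≤ C * ‖f‖ := by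
    intro n f
    refine (norm_le (by positivity)).mpr fun x => ?_
    rw [hiter]
    exact norm_iterate_weightedTransfer_le hC0 hw (norm_nonneg f) f.norm_coe_le_norm n x
  have hVit : ∀ n, R^[n] f ∈ V := by
    intro n
    induction n with
    | zero => exact hf
    | succ n ih => rw [Function.iterate_succ_apply']; exact hRV _ ih
  have hVces : ∀ k, cesaroMean R k f ∈ V := fun k =>
    V.smul_mem _ (V.sum_mem fun j _ => hVit j)
  set D := 2 * C * (√(C * Fintype.card I) * L / (1 - θ)) * ‖f‖ with hD
  have hθ' : 0 < 1 - θ := by linarith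
  have hD0 : 0 ≤ D := by positivity
  -- all iterates, hence all Cesàro means, share a modulus of continuity
  have hmod : ∀ ε > 0, ∃ δ > 0, ∀ x y, dist x y < δ → ∀ k,
      dist (cesaroMean R k f x) (cesaroMean R k f y) < ε := by
    intro ε hε
    obtain ⟨δ, hδ, hfδ⟩ := Metric.uniformContinuous_iff.mp hfu (ε / 4 / (C + 1)) (by positivity)
    refine ⟨min δ (ε / 4 / (D + 1)), by positivity, fun x y hxy k => ?_⟩
    have hit : ∀ n, ‖R^[n] f x - R^[n] f y‖ ≤ ε / 2 := by
      intro n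
      rw [hiter]
      have h1 := norm_iterate_weightedTransfer_sub_le hθ0 hθ1 hC0 hL hψ ha hw (norm_nonneg f)
        (ε := ε / 4 / (C + 1)) (by positivity) f.norm_coe_le_norm n x y (fun w => by
          rw [← dist_eq_norm]
          refine (hfδ (lt_of_le_of_lt (dist_wordBranch_le hθ0 hψ n w x y) ?_)).le
          refine lt_of_le_of_lt ?_ (hxy.trans_le (min_le_left _ _))
          exact mul_le_of_le_one_left dist_nonneg (pow_le_one₀ hθ0 hθ1.le))
      rw [← hD] at h1
      have h2 : C * (ε / 4 / (C + 1)) ≤ ε / 4 := by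
        rw [mul_div_assoc', div_le_iff₀ (by positivity)]; nlinarith
      have h3 : D * dist x y ≤ ε / 4 := by
        have := hxy.trans_le (min_le_right δ (ε / 4 / (D + 1)))
        rw [lt_div_iff₀ (by positivity)] at this
        nlinarith [dist_nonneg (x := x) (y := y)]
      linarith
    refine lt_of_le_of_lt (b := ε / 2) ?_ (by linarith)
    rw [dist_eq_norm]
    have e : cesaroMean R k f x - cesaroMean R k f y =
        (k : ℂ)⁻¹ • ∑ j ∈ Finset.Icc 1 k, (R^[j] f x - R^[j] f y) := by
      rw [Finset.sum_sub_distrib, smul_sub]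
      simp [cesaroMean, BoundedContinuousFunction.sum_apply]
    rw [e]
    exact norm_inv_smul_sum_Icc_le (by positivity) hit k
  have : CompactSpace K := isCompact_iff_compactSpace.mp hK
  let F : ℕ → (K →ᵇ (H →L[ℂ] H)) := fun k => (cesaroMean R k f).domRestrict K
  have hcomp : IsCompact (closure (Set.range F)) := by
    have : ProperSpace (H →L[ℂ] H) := FiniteDimensional.proper ℂ _
    refine arzela_ascoli (Metric.closedBall 0 (C * ‖f‖)) (isCompact_closedBall _ _) _ ?_ ?_
    · rintro _ x ⟨k, rfl⟩
      rw [mem_closedBall_zero_iff]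
      exact ((cesaroMean R k f).norm_coe_le_norm x).trans
        (norm_cesaroMean_le hC0 (fun n => hpow n f) k)
    · intro x
      rw [Metric.equicontinuousAt_iff]
      intro ε hε
      obtain ⟨δ, hδ, h⟩ := hmod ε hε
      refine ⟨δ, hδ, fun y hy => ?_⟩
      rintro ⟨_, k, rfl⟩
      exact h x y (by rw [dist_comm]; exact hy) k
  obtain ⟨F₀, _, n, hn, hF₀⟩ := hcomp.tendsto_subseq (x := F) (fun k => subset_closure ⟨k, rfl⟩)
  have hcauchy : CauchySeq (fun j => cesaroMean R (n j) f) := by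
    rw [Metric.cauchySeq_iff']
    intro ε hε
    obtain ⟨N, hN⟩ := Metric.cauchySeq_iff'.mp hF₀.cauchySeq (ε / 2) (by positivity)
    refine ⟨N, fun j hj => lt_of_le_of_lt (b := ε / 2) ?_ (by linarith)⟩
    rw [dist_eq_norm, norm_le (by positivity)]
    intro x
    obtain ⟨k, hk, hxk⟩ := hVK _ (V.sub_mem (hVces (n j)) (hVces (n N))) x
    rw [hxk, BoundedContinuousFunction.sub_apply, ← dist_eq_norm]
    exact (dist_coe_le_dist (f := F (n j)) (g := F (n N)) ⟨k, hk⟩).trans (hN j hj).le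
  obtain ⟨g, hg⟩ := cauchySeq_tendsto_of_complete hcauchy
  exact ⟨g, tendsto_cesaroMean_of_mapClusterPt hC0 hpow
    (MapClusterPt.of_comp hn.tendsto_atTop hg.mapClusterPt)⟩

/-- Convergence of the Cesàro means, for plain functions in place of the Banach space of bounded
continuous ones. -/
theorem exists_tendstoUniformly_cesaroMean_weightedTransfer [FiniteDimensional ℂ H] {θ C L : ℝ}
    (hθ0 : 0 ≤ θ) (hθ1 : θ < 1) (hC0 : 0 ≤ C) (hL : 0 ≤ L)
    (hψ : ∀ i x y, dist (ψ i x) (ψ i y) ≤ θ * dist x y)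
    (ha : ∀ i x y, ‖a i x - a i y‖ ≤ L * dist x y)
    (hw : ∀ n x v, ∑ w : Fin n → I, ‖wordWeight ψ a n w x v‖ ^ 2 ≤ C * ‖v‖ ^ 2)
    {V : Submodule ℂ (Y → (H →L[ℂ] H))} (hRV : ∀ f ∈ V, weightedTransfer ψ a f ∈ V)
    {K : Set Y} (hK : IsCompact K) (hVK : ∀ f ∈ V, ∀ x, ∃ k ∈ K, ‖f x‖ = ‖f k‖)
    {f : Y → (H →L[ℂ] H)} (hf : f ∈ V) (hfu : UniformContinuous f) {B : ℝ}
    (hB : ∀ x, ‖f x‖ ≤ B) :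
    ∃ g, Continuous g ∧ weightedTransfer ψ a g = g ∧
      TendstoUniformly (fun k => cesaroMean (weightedTransfer ψ a) k f) g atTop := by
  have hψc : ∀ i, Continuous (ψ i) := fun i =>
    (LipschitzWith.of_dist_le_mul (K := ⟨θ, hθ0⟩) (hψ i)).continuous
  have hac : ∀ i, Continuous (a i) := fun i =>
    (LipschitzWith.of_dist_le_mul (K := ⟨L, hL⟩)
      (fun x y => by rw [dist_eq_norm]; exact ha i x y)).continuous
  obtain ⟨R, hR⟩ := exists_weightedTransfer_clm hC0 hψc hac hw
  let V' : Submodule ℂ (Y →ᵇ (H →L[ℂ] H)) :=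
    { carrier := {f | ⇑f ∈ V}
      zero_mem' := V.zero_mem
      add_mem' := fun hf hg => V.add_mem hf hg
      smul_mem' := fun c _ hf => V.smul_mem c hf }
  obtain ⟨g, hg, hlim⟩ := exists_tendsto_cesaroMean_weightedTransfer hθ0 hθ1 hC0 hL hψ ha hw hR
    (V := V') (fun f hf => by
      have : ⇑(R f) = weightedTransfer ψ a f := funext (hR f)
      change ⇑(R f) ∈ V
      rw [this]
      exact hRV _ hf) hK (fun f hf => hVK f hf)
    (f := ofNormedAddCommGroup f hfu.continuous B hB) hf hfu
  refine ⟨g, g.continuous, ?_, ?_⟩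
  · exact (funext (hR g)).symm.trans (congrArg DFunLike.coe hg)
  · rw [tendsto_iff_tendstoUniformly] at hlim
    have hiter : ∀ n, ⇑(R^[n] (ofNormedAddCommGroup f hfu.continuous B hB)) =
        (weightedTransfer ψ a)^[n] f := fun n =>
      (Function.Semiconj.iterate_right (f := fun f : Y →ᵇ (H →L[ℂ] H) => ⇑f)
        (fun f => funext (hR f)) n) _
    have hces : (fun k => cesaroMean (weightedTransfer ψ a) k f) =
        fun k => ⇑(cesaroMean R k (ofNormedAddCommGroup f hfu.continuous B hB)) := by
      funext k x
      simp [cesaroMean, BoundedContinuousFunction.sum_apply, hiter]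
    rw [hces]
    exact hlim

end TransferConvergence

/-! ### The transfer operator of an expansive system in the frames -/

section BranchWeights

namespace ExpansiveSystem

variable {G Y : Type*} [Group G] [MetricSpace Y] [MulAction G Y] (S : ExpansiveSystem G Y)
  {q : ℕ} (rep : Fin q → G)

theorem dist_branch_le [IsIsometricSMul G Y] (i : Fin q) (x y : Y) :
    dist (S.branch rep i x) (S.branch rep i y) ≤ S.θ * dist x y := by
  have h := S.expansive (S.branch rep i x) (S.branch rep i y)
  simpa [branch] using h

variable {d : ℕ} {E : OrbitSpace G Y → Type*}
  [∀ y, NormedAddCommGroup (E y)] [∀ y, InnerProductSpace ℂ (E y)]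
  (u : ∀ x : Y, EuclideanSpace ℂ (Fin d) ≃ₗᵢ[ℂ] E (orbitProj G x))
  (m : ∀ z, E (S.baseMap z) →L[ℂ] E z)

/-- The matrix `u_{ψᵢ x}⁻¹ m(p ψᵢ x) u_x` of `m` along the branch `ψᵢ`. -/
noncomputable def branchWeight (i : Fin q) (x : Y) :
    EuclideanSpace ℂ (Fin d) →L[ℂ] EuclideanSpace ℂ (Fin d) :=
  ((u (S.branch rep i x)).symm.toContinuousLinearEquiv :
      E (orbitProj G (S.branch rep i x)) →L[ℂ] EuclideanSpace ℂ (Fin d)) ∘L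
    (S.fibreMap m (orbitProj G (S.branch rep i x)) (orbitProj G x) (S.baseMap_branch rep i x)) ∘L
    ((u x).toContinuousLinearEquiv : EuclideanSpace ℂ (Fin d) →L[ℂ] E (orbitProj G x))

theorem branchWeight_eq (i : Fin q) (x : Y) :
    S.branchWeight rep u m i x =
      pullBundleMap S u m (S.branch rep i x) ∘L deckChange u (rep i) x := by
  have key : ∀ {y y' z : OrbitSpace G Y} (h : y = y') (hz : S.baseMap z = y)
      (hz' : S.baseMap z = y') (w : E y),
      S.fibreMap m z y' hz' (fibreCast E h w) = S.fibreMap m z y hz w := by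
    intro y y' z h hz hz' w
    subst h; rfl
  have hdil : S.dil (S.branch rep i x) = rep i • x := by simp [branch]
  have hpx : orbitProj G x = orbitProj G (S.dil (S.branch rep i x)) := by
    rw [hdil, orbitProj_smul]
  rw [← frameChange_eq_deckChange u hdil hpx]
  ext1 v
  simp [branchWeight, pullBundleMap, frameChange_apply, key hpx (S.baseMap_branch rep i x)]

variable [∀ y, CompleteSpace (E y)]

theorem pullEnd_transferOp (hrep : S.IsRightTransversal rep) (h : ∀ y, E y →L[ℂ] E y) :
    pullEnd u (S.transferOp m rep h) =
      weightedTransfer (S.branch rep) (S.branchWeight rep u m) (pullEnd u h) := by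
  ext x v : 2
  refine ext_inner_left ℂ fun w => ?_
  rw [pullEnd_apply, S.transferOp_orbitProj m rep hrep]
  have hsymm : ∀ z : E (orbitProj G x), inner ℂ w ((u x).symm z) = inner ℂ (u x w) z := by
    intro z
    rw [← (u x).inner_map_map, LinearIsometryEquiv.apply_symm_apply]
  rw [hsymm]
  simp only [weightedTransfer, transferTerm, sum_apply, inner_sum,
    ContinuousLinearMap.comp_apply, ContinuousLinearMap.adjoint_inner_right]
  refine Finset.sum_congr rfl fun i _ => ?_
  rw [pullEnd_apply]
  rw [← (u (S.branch rep i x)).inner_map_map, LinearIsometryEquiv.apply_symm_apply]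
  simp [branchWeight]

theorem pullEnd_iterate_transferOp (hrep : S.IsRightTransversal rep) (n : ℕ)
    (h : ∀ y, E y →L[ℂ] E y) :
    pullEnd u ((S.transferOp m rep)^[n] h) =
      (weightedTransfer (S.branch rep) (S.branchWeight rep u m))^[n] (pullEnd u h) :=
  (Function.Semiconj.iterate_right (f := pullEnd u) (S.pullEnd_transferOp rep u m hrep) n) h

omit [∀ y, CompleteSpace (E y)] in
theorem norm_branchWeight_sub_le [IsIsometricSMul G Y] {Λ M : ℝ}
    (hΛ : ∀ (g : G) x y, ‖deckChange u g x - deckChange u g y‖ ≤ Λ * dist x y)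
    {L : ℝ≥0} (hm : LipschitzWith L (pullBundleMap S u m)) (hM0 : 0 ≤ M)
    (hM : ∀ i x, ‖S.branchWeight rep u m i x‖ ≤ M) (i : Fin q) (x y : Y) :
    ‖S.branchWeight rep u m i x - S.branchWeight rep u m i y‖ ≤
      (L * S.θ + M * Λ) * dist x y := by
  have hpull : ‖pullBundleMap S u m (S.branch rep i y)‖ ≤ M := by
    refine ContinuousLinearMap.opNorm_le_bound _ hM0 fun v => ?_
    obtain ⟨w, rfl⟩ : ∃ w, deckChange u (rep i) y w = v := by
      refine ⟨deckChange u (rep i)⁻¹ (rep i • y) v, ?_⟩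
      have := deckChange_inv_apply u (rep i)⁻¹ (rep i • y) v
      rw [inv_inv, inv_smul_smul] at this
      exact this
    have h1 := (S.branchWeight rep u m i y).le_of_opNorm_le (hM i y) w
    rw [branchWeight_eq, ContinuousLinearMap.comp_apply] at h1
    rwa [norm_deckChange_apply]
  have h1 : ‖pullBundleMap S u m (S.branch rep i x) - pullBundleMap S u m (S.branch rep i y)‖ ≤
      L * (S.θ * dist x y) := by
    rw [← dist_eq_norm]
    refine (hm.dist_le_mul _ _).trans ?_
    gcongr
    exact S.dist_branch_le rep i x y
  rw [branchWeight_eq, branchWeight_eq]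
  calc _ ≤ L * (S.θ * dist x y) * 1 + M * (Λ * dist x y) := by
        refine (norm_comp_sub_comp_le _ _ _ _).trans (add_le_add ?_ ?_)
        · have := (norm_nonneg _).trans h1
          gcongr
          exact norm_deckChange_le u _ _
        · gcongr
          exact hΛ _ _ _
    _ = _ := by ring

end ExpansiveSystem

end BranchWeights

/-! ### Cesàro means on `End(ξ)` -/

section CesaroLimit

section PullBack

variable {G Y : Type*} [Group G] [MulAction G Y]

theorem pullEnd_cesaroMean {d : ℕ} {E : OrbitSpace G Y → Type*}
    [∀ y, NormedAddCommGroup (E y)] [∀ y, InnerProductSpace ℂ (E y)]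
    (u : ∀ x : Y, EuclideanSpace ℂ (Fin d) ≃ₗᵢ[ℂ] E (orbitProj G x))
    (R : (∀ y, E y →L[ℂ] E y) → ∀ y, E y →L[ℂ] E y) (k : ℕ) (h : ∀ y, E y →L[ℂ] E y) :
    pullEnd u (cesaroMean R k h) = (k : ℂ)⁻¹ • ∑ j ∈ Finset.Icc 1 k, pullEnd u (R^[j] h) := by
  let P : (∀ y, E y →L[ℂ] E y) →ₗ[ℂ]
      (Y → EuclideanSpace ℂ (Fin d) →L[ℂ] EuclideanSpace ℂ (Fin d)) :=
    { toFun := pullEnd u, map_add' := pullEnd_add u, map_smul' := pullEnd_smul u }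
  have := map_smul P (k : ℂ)⁻¹ (∑ j ∈ Finset.Icc 1 k, R^[j] h)
  rw [map_sum] at this
  exact this

theorem supNorm_le {d : ℕ} {E : OrbitSpace G Y → Type*}
    [∀ y, NormedAddCommGroup (E y)] [∀ y, InnerProductSpace ℂ (E y)]
    (u : ∀ x : Y, EuclideanSpace ℂ (Fin d) ≃ₗᵢ[ℂ] E (orbitProj G x))
    {h : ∀ y, E y →L[ℂ] E y} {B : ℝ} (hB : ∀ x, ‖pullEnd u h x‖ ≤ B) :
    supNorm h ≤ ENNReal.ofReal B := by
  refine iSup_le fun y => ?_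
  obtain ⟨x, rfl⟩ := orbitProj_surjective y
  rw [← ofReal_norm, ← norm_pullEnd u]
  exact ENNReal.ofReal_le_ofReal (hB x)

theorem norm_pullEnd_le_of_supNorm_le {d : ℕ} {E : OrbitSpace G Y → Type*}
    [∀ y, NormedAddCommGroup (E y)] [∀ y, InnerProductSpace ℂ (E y)]
    (u : ∀ x : Y, EuclideanSpace ℂ (Fin d) ≃ₗᵢ[ℂ] E (orbitProj G x))
    {h : ∀ y, E y →L[ℂ] E y} {B : ℝ≥0} (hB : supNorm h ≤ B) (x : Y) : ‖pullEnd u h x‖ ≤ B := by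
  rw [norm_pullEnd]
  have h1 : ‖h (orbitProj G x)‖ₑ ≤ B := (le_iSup (fun y => ‖h y‖ₑ) (orbitProj G x)).trans hB
  exact_mod_cast (ENNReal.coe_le_coe.mp h1)

/-- Positivity of a matrix of operators is preserved by the iterates of a transfer operator, since
these are sums of congruences. -/
theorem sum_inner_iterate_weightedTransfer_nonneg {Y H I : Type*} [NormedAddCommGroup H]
    [InnerProductSpace ℂ H] [CompleteSpace H] [Fintype I] (ψ : I → Y → Y) (a : I → Y → H →L[ℂ] H)
    {n : ℕ} {f : Fin n → Fin n → Y → H →L[ℂ] H}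
    (hf : ∀ x (v : Fin n → H), 0 ≤ ∑ i, ∑ j, inner ℂ (v i) (f i j x (v j))) (k : ℕ) (x : Y)
    (v : Fin n → H) :
    0 ≤ ∑ i, ∑ j, inner ℂ (v i) ((weightedTransfer ψ a)^[k] (f i j) x (v j)) := by
  have h : ∑ i, ∑ j, inner ℂ (v i) ((weightedTransfer ψ a)^[k] (f i j) x (v j)) =
      ∑ w : Fin k → I, ∑ i, ∑ j, inner ℂ (wordWeight ψ a k w x (v i))
        (f i j (wordBranch ψ k w x) (wordWeight ψ a k w x (v j))) := by
    simp only [inner_iterate_weightedTransfer]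
    exact (Finset.sum_congr rfl fun i _ => Finset.sum_comm).trans Finset.sum_comm
  rw [h]
  exact Finset.sum_nonneg fun w _ => hf _ _

/-- The matrix functions on `Y` which are compatible with the changes of frame. -/
def equivariantFunctions {d : ℕ} {E : OrbitSpace G Y → Type*}
    [∀ y, NormedAddCommGroup (E y)] [∀ y, InnerProductSpace ℂ (E y)]
    (u : ∀ x : Y, EuclideanSpace ℂ (Fin d) ≃ₗᵢ[ℂ] E (orbitProj G x)) :
    Submodule ℂ (Y → (EuclideanSpace ℂ (Fin d) →L[ℂ] EuclideanSpace ℂ (Fin d))) where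
  carrier := {f | ∀ (x x' : Y) (e : orbitProj G x = orbitProj G x') (v : EuclideanSpace ℂ (Fin d)),
      f x' (frameChange u e v) = frameChange u e (f x v)}
  zero_mem' := by
    intro x x' e v
    simp
  add_mem' := by
    intro f g hf hg x x' e v
    simp [hf x x' e v, hg x x' e v]
  smul_mem' := by
    intro c f hf x x' e v
    simp [hf x x' e v]

theorem pullEnd_mem_equivariantFunctions {d : ℕ} {E : OrbitSpace G Y → Type*}
    [∀ y, NormedAddCommGroup (E y)] [∀ y, InnerProductSpace ℂ (E y)]
    (u : ∀ x : Y, EuclideanSpace ℂ (Fin d) ≃ₗᵢ[ℂ] E (orbitProj G x))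
    (h : ∀ y, E y →L[ℂ] E y) : pullEnd u h ∈ equivariantFunctions u :=
  fun _ _ e v => pullEnd_frameChange u h e v

end PullBack

namespace ExpansiveSystem

variable {G Y : Type*} [Group G] [MetricSpace Y] [MulAction G Y] (S : ExpansiveSystem G Y)
  {q : ℕ} {rep : Fin q → G} {d : ℕ} {E : OrbitSpace G Y → Type*}
  [∀ y, NormedAddCommGroup (E y)] [∀ y, InnerProductSpace ℂ (E y)] [∀ y, CompleteSpace (E y)]
  {u : ∀ x : Y, EuclideanSpace ℂ (Fin d) ≃ₗᵢ[ℂ] E (orbitProj G x)}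
  {m : ∀ z, E (S.baseMap z) →L[ℂ] E z}

theorem pullEnd_cesaroMean_transferOp (hrep : S.IsRightTransversal rep) (k : ℕ)
    (h : ∀ y, E y →L[ℂ] E y) :
    pullEnd u (cesaroMean (S.transferOp m rep) k h) =
      cesaroMean (weightedTransfer (S.branch rep) (S.branchWeight rep u m)) k (pullEnd u h) := by
  refine (pullEnd_cesaroMean u _ k h).trans ?_
  exact congrArg _ (Finset.sum_congr rfl fun j _ => S.pullEnd_iterate_transferOp rep u m hrep j h)

variable [TopologicalSpace (TotalSpace (EuclideanSpace ℂ (Fin d)) E)]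
  [FiberBundle (EuclideanSpace ℂ (Fin d)) E] [VectorBundle ℂ (EuclideanSpace ℂ (Fin d)) E]

/-- The bound on the powers of the transfer operator, used for the identity endomorphism only,
bounds the square sums of the word weights. -/
theorem sum_norm_wordWeight_branchWeight_sq_le (hrep : S.IsRightTransversal rep) {C : ℝ≥0}
    (hC : ∀ k : ℕ, ∀ h ∈ bundleEnd d E,
      supNorm ((S.transferOp m rep)^[k] h) ≤ C * supNorm h) (n : ℕ) (x : Y)
    (v : EuclideanSpace ℂ (Fin d)) :
    ∑ w : Fin n → Fin q,
      ‖wordWeight (S.branch rep) (S.branchWeight rep u m) n w x v‖ ^ 2 ≤ C * ‖v‖ ^ 2 := by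
  refine sum_norm_wordWeight_sq_le (fun n x => ?_) n x v
  have hid : (fun y => ContinuousLinearMap.id ℂ (E y)) ∈ bundleEnd d E := by
    change Continuous fun v : TotalSpace (EuclideanSpace ℂ (Fin d)) E =>
      TotalSpace.mk' (EuclideanSpace ℂ (Fin d)) v.1 v.2
    exact continuous_id
  have hpid : pullEnd u (fun y => ContinuousLinearMap.id ℂ (E y)) =
      fun _ => ContinuousLinearMap.id ℂ (EuclideanSpace ℂ (Fin d)) := by
    ext x v : 2
    simp [pullEnd_apply]
  have h1 : supNorm (fun y => ContinuousLinearMap.id ℂ (E y)) ≤ 1 := by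
    rw [← ENNReal.ofReal_one]
    refine supNorm_le u fun x => ?_
    rw [hpid]
    exact ContinuousLinearMap.norm_id_le
  rw [← hpid, ← S.pullEnd_iterate_transferOp rep u m hrep]
  refine norm_pullEnd_le_of_supNorm_le u ((hC n _ hid).trans ?_) x
  calc _ ≤ (C : ℝ≥0∞) * 1 := by gcongr
    _ = C := mul_one _

variable {ι : Type*} {φ : ι → Trivialization (EuclideanSpace ℂ (Fin d))
      (TotalSpace.proj : TotalSpace (EuclideanSpace ℂ (Fin d)) E → OrbitSpace G Y)}
    [∀ i, (φ i).IsLinear ℂ]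

/-- The Cesàro means of a continuous endomorphism converge uniformly to a continuous endomorphism
fixed by the transfer operator. -/
theorem exists_tendstoUniformly_pullEnd_cesaroMean
    (hp : IsQuotientCoveringMap (orbitProj G : Y → OrbitSpace G Y) G)
    (hrep : S.IsRightTransversal rep)
    (hφ : IsLipschitzTrivializingSystem φ) (hu : IsLipschitzFrame φ u) {K : Set Y}
    (hK : IsCompact K) (hGK : ∀ x : Y, ∃ g : G, ∃ k ∈ K, x = g • k) {C L : ℝ}
    (hC0 : 0 ≤ C) (hL : 0 ≤ L)
    (hψ : ∀ i x y, dist (S.branch rep i x) (S.branch rep i y) ≤ S.θ * dist x y)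
    (ha : ∀ i x y, ‖S.branchWeight rep u m i x - S.branchWeight rep u m i y‖ ≤ L * dist x y)
    (hw : ∀ n x v, ∑ w : Fin n → Fin q,
      ‖wordWeight (S.branch rep) (S.branchWeight rep u m) n w x v‖ ^ 2 ≤ C * ‖v‖ ^ 2)
    {h : ∀ y, E y →L[ℂ] E y} (hh : UniformContinuous (pullEnd u h)) :
    ∃ h' ∈ bundleEnd d E, S.transferOp m rep h' = h' ∧
      TendstoUniformly (fun k => pullEnd u (cesaroMean (S.transferOp m rep) k h)) (pullEnd u h')
        atTop := by
  have hV : ∀ f ∈ equivariantFunctions u, ∃ h, pullEnd u h = f := fun f hf =>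
    exists_pullEnd_eq u hf
  obtain ⟨B, -, hB⟩ := exists_norm_le_of_invariant hK hGK hh.continuous
    (fun g x => by rw [norm_pullEnd, norm_pullEnd, orbitProj_smul])
  obtain ⟨f, hfc, hfix, hlim⟩ := exists_tendstoUniformly_cesaroMean_weightedTransfer S.θ_pos.le
    S.θ_lt_one hC0 hL hψ ha hw (V := equivariantFunctions u) (fun f hf => by
      obtain ⟨h, rfl⟩ := hV f hf
      rw [← S.pullEnd_transferOp rep u m hrep]
      exact pullEnd_mem_equivariantFunctions u _) hK (fun f hf x => by
      obtain ⟨h, rfl⟩ := hV f hf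
      obtain ⟨g, k, hk, rfl⟩ := hGK x
      exact ⟨k, hk, by rw [norm_pullEnd, norm_pullEnd, orbitProj_smul]⟩)
    (pullEnd_mem_equivariantFunctions u h) hh hB
  simp only [← S.pullEnd_cesaroMean_transferOp hrep] at hlim
  have hfV : f ∈ equivariantFunctions u := by
    intro x x' e v
    have h1 := ((ContinuousLinearMap.apply ℂ _ (frameChange u e v)).continuous.tendsto _).comp
      (hlim.tendsto_at x')
    have h2 := ((frameChange u e).continuous.tendsto _).comp
      (((ContinuousLinearMap.apply ℂ _ v).continuous.tendsto _).comp (hlim.tendsto_at x))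
    refine tendsto_nhds_unique h1 (h2.congr fun k => ?_)
    exact (pullEnd_frameChange u _ e v).symm
  obtain ⟨h', rfl⟩ := hV f hfV
  refine ⟨h', mem_bundleEnd_of_continuous_pullEnd hp hφ hu hfc, pullEnd_injective u ?_, hlim⟩
  rw [S.pullEnd_transferOp rep u m hrep, hfix]

omit [TopologicalSpace (TotalSpace (EuclideanSpace ℂ (Fin d)) E)]
  [FiberBundle (EuclideanSpace ℂ (Fin d)) E] [VectorBundle ℂ (EuclideanSpace ℂ (Fin d)) E] in
/-- Pointwise limits of Cesàro means preserve the positivity of matrices. -/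
theorem sum_inner_nonneg_of_tendsto_cesaroMean (hrep : S.IsRightTransversal rep) {n : ℕ}
    {M M' : Fin n → Fin n → ∀ y, E y →L[ℂ] E y}
    (hM : ∀ (y : OrbitSpace G Y) (v : Fin n → E y), 0 ≤ ∑ i, ∑ j, inner ℂ (v i) (M i j y (v j)))
    (hlim : ∀ i j x, Tendsto (fun k => pullEnd u (cesaroMean (S.transferOp m rep) k (M i j)) x)
      atTop (𝓝 (pullEnd u (M' i j) x))) (y : OrbitSpace G Y) (v : Fin n → E y) :
    0 ≤ ∑ i, ∑ j, inner ℂ (v i) (M' i j y (v j)) := by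
  obtain ⟨x, rfl⟩ := orbitProj_surjective y
  have hpull : ∀ (f : ∀ y, E y →L[ℂ] E y) x (v v' : EuclideanSpace ℂ (Fin d)),
      inner ℂ v (pullEnd u f x v') = inner ℂ (u x v) (f (orbitProj G x) (u x v')) := by
    intro f x v v'
    rw [pullEnd_apply, ← (u x).inner_map_map v, LinearIsometryEquiv.apply_symm_apply]
  have hpos : ∀ x (v : Fin n → EuclideanSpace ℂ (Fin d)),
      0 ≤ ∑ i, ∑ j, inner ℂ (v i) (pullEnd u (M i j) x (v j)) := by
    intro x v
    simp only [hpull]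
    exact hM (orbitProj G x) (fun i => u x (v i))
  set w : Fin n → EuclideanSpace ℂ (Fin d) := fun i => (u x).symm (v i) with hw
  have hlim' : Tendsto (fun k => ∑ i, ∑ j,
      inner ℂ (w i) (pullEnd u (cesaroMean (S.transferOp m rep) k (M i j)) x (w j)))
      atTop (𝓝 (∑ i, ∑ j, inner ℂ (w i) (pullEnd u (M' i j) x (w j)))) := by
    refine tendsto_finsetSum _ fun i _ => tendsto_finsetSum _ fun j _ => ?_
    exact tendsto_const_nhds.inner
      (((ContinuousLinearMap.apply ℂ _ (w j)).continuous.tendsto _).comp (hlim i j x))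
  have hk : ∀ k, 0 ≤ ∑ i, ∑ j,
      inner ℂ (w i) (pullEnd u (cesaroMean (S.transferOp m rep) k (M i j)) x (w j)) := by
    intro k
    have h1 : ∀ i j, inner ℂ (w i) (pullEnd u (cesaroMean (S.transferOp m rep) k (M i j)) x (w j)) =
        (k : ℂ)⁻¹ * ∑ l ∈ Finset.Icc 1 k, inner ℂ (w i)
          ((weightedTransfer (S.branch rep) (S.branchWeight rep u m))^[l]
            (pullEnd u (M i j)) x (w j)) := by
      intro i j
      rw [pullEnd_cesaroMean]
      simp only [S.pullEnd_iterate_transferOp rep u m hrep, Pi.smul_apply, Finset.sum_apply,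
        _root_.smul_apply, _root_.sum_apply, inner_smul_right, inner_sum]
    have h2 : ∑ i, ∑ j,
        inner ℂ (w i) (pullEnd u (cesaroMean (S.transferOp m rep) k (M i j)) x (w j)) =
        (k : ℂ)⁻¹ * ∑ l ∈ Finset.Icc 1 k, ∑ i, ∑ j, inner ℂ (w i)
          ((weightedTransfer (S.branch rep) (S.branchWeight rep u m))^[l]
            (pullEnd u (M i j)) x (w j)) := by
      simp only [h1, ← Finset.mul_sum]
      congr 1
      exact (Finset.sum_congr rfl fun i _ => Finset.sum_comm).trans Finset.sum_comm
    rw [h2]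
    refine mul_nonneg (inv_nonneg.mpr (Nat.cast_nonneg k)) (Finset.sum_nonneg fun l _ => ?_)
    exact sum_inner_iterate_weightedTransfer_nonneg _ _ hpos l x w
  have h3 := ge_of_tendsto' hlim' hk
  simpa only [hpull, hw, LinearIsometryEquiv.apply_symm_apply] using h3

end ExpansiveSystem

end CesaroLimit

theorem mainTheorem5
    {G Y : Type*} [Group G] [MetricSpace Y] [LocallyCompactSpace Y] [MulAction G Y]
    [IsIsometricSMul G Y]
    -- the action is properly discontinuous and `p : Y → X = Y / G` is a quotient covering map
    [ProperlyDiscontinuousSMul G Y]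
    (hp : IsQuotientCoveringMap (orbitProj G : Y → OrbitSpace G Y) G)
    [CompactSpace (OrbitSpace G Y)]
    (S : ExpansiveSystem G Y)
    {q : ℕ} (rep : Fin q → G) (hrep : S.IsRightTransversal rep)
    -- a Hermitian complex vector bundle `ξ` of rank `d` over `X`
    {d : ℕ} (E : OrbitSpace G Y → Type*)
    [TopologicalSpace (TotalSpace (EuclideanSpace ℂ (Fin d)) E)]
    [∀ y, NormedAddCommGroup (E y)] [∀ y, InnerProductSpace ℂ (E y)] [∀ y, CompleteSpace (E y)]
    [FiberBundle (EuclideanSpace ℂ (Fin d)) E] [VectorBundle ℂ (EuclideanSpace ℂ (Fin d)) E]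
    -- `ξ` is Lipschitz continuous
    {ι : Type*} (φ : ι → Trivialization (EuclideanSpace ℂ (Fin d))
      (TotalSpace.proj : TotalSpace (EuclideanSpace ℂ (Fin d)) E → OrbitSpace G Y))
    [∀ i, (φ i).IsLinear ℂ] (hφ : IsLipschitzTrivializingSystem φ)
    -- the identification of `p^*ξ` with `Y × ℂ^d`
    (u : ∀ x : Y, EuclideanSpace ℂ (Fin d) ≃ₗᵢ[ℂ] E (orbitProj G x))
    (hu : IsLipschitzFrame φ u)
    -- the bundle map `m : r^*ξ → ξ`, Lipschitz continuous
    (m : ∀ z, E (S.baseMap z) →L[ℂ] E z)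
    (hm : ∃ K : ℝ≥0, LipschitzWith K (pullBundleMap S u m))
    -- `sup_k ‖R^k‖_∞ < ∞`
    (hR : ∃ C : ℝ≥0, ∀ k : ℕ, ∀ h ∈ bundleEnd d E,
      supNorm ((S.transferOp m rep)^[k] h) ≤ C * supNorm h) :
    ∃ T : bundleEnd d E →ₗ[ℂ] bundleEnd d E,
      (∀ g : bundleEnd d E, Tendsto
        (fun k : ℕ => supNorm (cesaroMean (S.transferOp m rep) k
          (g : ∀ y, E y →L[ℂ] E y) - (T g : ∀ y, E y →L[ℂ] E y))) atTop (𝓝 0)) ∧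
      IsCompletelyPositive T ∧
      T ∘ₗ T = T ∧
      (∃ C : ℝ≥0, ∀ g : bundleEnd d E, (g : ∀ y, E y →L[ℂ] E y) ∈ lipEnd u →
        (T g : ∀ y, E y →L[ℂ] E y) ∈ lipEnd u ∧
          lipOpNorm u (T g : ∀ y, E y →L[ℂ] E y) ≤
            C * lipOpNorm u (g : ∀ y, E y →L[ℂ] E y)) ∧
      {g : ∀ y, E y →L[ℂ] E y | ∃ f : bundleEnd d E, (T f : ∀ y, E y →L[ℂ] E y) = g} =
        {g | g ∈ bundleEnd d E ∧ S.transferOp m rep g = g} ∧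
      {g : ∀ y, E y →L[ℂ] E y | g ∈ bundleEnd d E ∧ S.transferOp m rep g = g} =
        {g | g ∈ lipEnd u ∧ S.transferOp m rep g = g} := by
  obtain ⟨K, hK, hGK⟩ := exists_isCompact_orbitProj hp
  obtain ⟨Λ, hΛ0, hΛ⟩ := exists_deckChange_lipschitz hp hφ hu hK hGK
  obtain ⟨δ, hδ, hinj⟩ := exists_injectivity_radius hp hK hGK
  obtain ⟨Lm, hLm⟩ := hm
  obtain ⟨C, hC⟩ := hR
  have hC0 : (0 : ℝ) ≤ C := C.2
  have hθ0 := S.θ_pos.le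
  have hθ1 := S.θ_lt_one
  have hψ := S.dist_branch_le rep
  have hw := S.sum_norm_wordWeight_branchWeight_sq_le (u := u) (m := m) hrep hC
  have ha := S.norm_branchWeight_sub_le rep u m hΛ hLm (Real.sqrt_nonneg C)
    (norm_weight_le_sqrt hC0 hw)
  have hL0 : 0 ≤ Lm * S.θ + √C * Λ := by positivity
  set L := Lm * S.θ + √C * Λ with hLdef
  have huc : ∀ h ∈ bundleEnd d E, UniformContinuous (pullEnd u h) := fun h hh =>
    uniformContinuous_pullEnd hK hGK hΛ0 hΛ (continuous_pullEnd hp hφ hu hh)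
  have hbd : ∀ h ∈ bundleEnd d E, ∃ B, 0 ≤ B ∧ ∀ x, ‖pullEnd u h x‖ ≤ B := fun h hh =>
    exists_norm_le_of_invariant hK hGK (continuous_pullEnd hp hφ hu hh)
      (fun g x => by rw [norm_pullEnd, norm_pullEnd, orbitProj_smul])
  -- fixed points of `R` are Lipschitz, with a constant controlled by the sup-norm
  set D := 2 * C * (√(C * Fintype.card (Fin q)) * L / (1 - S.θ)) with hDdef
  have hD0 : 0 ≤ D := by
    have : 0 < 1 - S.θ := by linarith
    positivity
  have hlip : ∀ h ∈ bundleEnd d E, S.transferOp m rep h = h → ∀ B, 0 ≤ B →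
      (∀ x, ‖pullEnd u h x‖ ≤ B) → ∀ x y,
      ‖pullEnd u h x - pullEnd u h y‖ ≤ D * B * dist x y := by
    intro h hh hfix B hB0 hB x y
    refine norm_sub_le_of_weightedTransfer_eq hθ0 hθ1 hC0 hL0 hψ ha hw hB0 hB (huc h hh) ?_ x y
    rw [← S.pullEnd_transferOp rep u m hrep, hfix]
  have hmemL : ∀ h ∈ bundleEnd d E, S.transferOp m rep h = h → h ∈ lipEnd u := by
    intro h hh hfix
    obtain ⟨B, hB0, hB⟩ := hbd h hh
    exact mem_lipEnd_of_lipschitz hp hφ hu hK hGK hh hB0 (by positivity) hB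
      (hlip h hh hfix B hB0 hB)
  -- the limits of the Cesàro means
  have hconv : ∀ h : bundleEnd d E, ∃ h' : bundleEnd d E,
      S.transferOp m rep (h' : ∀ y, E y →L[ℂ] E y) = h' ∧
      TendstoUniformly (fun k => pullEnd u (cesaroMean (S.transferOp m rep) k
        (h : ∀ y, E y →L[ℂ] E y))) (pullEnd u (h' : ∀ y, E y →L[ℂ] E y)) atTop := by
    intro h
    obtain ⟨h', hh', hfix, hlim⟩ := S.exists_tendstoUniformly_pullEnd_cesaroMean hp hrep hφ hu hK
      hGK hC0 hL0 hψ ha hw (huc h h.2)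
    exact ⟨⟨h', hh'⟩, hfix, hlim⟩
  choose T hTfix hTlim using hconv
  have huniq : ∀ h h' : bundleEnd d E, (∀ x, Tendsto (fun k => pullEnd u (cesaroMean
      (S.transferOp m rep) k (h : ∀ y, E y →L[ℂ] E y)) x) atTop
      (𝓝 (pullEnd u (h' : ∀ y, E y →L[ℂ] E y) x))) → T h = h' := by
    intro h h' hh'
    refine Subtype.ext (pullEnd_injective u (funext fun x => ?_))
    exact tendsto_nhds_unique ((hTlim h).tendsto_at x) (hh' x)
  have hfixT : ∀ h : bundleEnd d E, S.transferOp m rep (h : ∀ y, E y →L[ℂ] E y) = h → T h = h := by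
    intro h hh
    refine huniq h h fun x => tendsto_const_nhds.congr' ?_
    filter_upwards [eventually_ne_atTop 0] with k hk
    rw [cesaroMean_of_fixed hh hk]
  have hTnorm : ∀ (h : bundleEnd d E) B, 0 ≤ B →
      (∀ x, ‖pullEnd u (h : ∀ y, E y →L[ℂ] E y) x‖ ≤ B) →
      ∀ x, ‖pullEnd u (T h : ∀ y, E y →L[ℂ] E y) x‖ ≤ C * B := by
    intro h B hB0 hB x
    refine le_of_tendsto' ((hTlim h).tendsto_at x).norm fun k => ?_
    rw [pullEnd_cesaroMean, Pi.smul_apply, Finset.sum_apply]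
    refine norm_inv_smul_sum_Icc_le (by positivity) (fun n => ?_) k
    rw [S.pullEnd_iterate_transferOp rep u m hrep]
    exact norm_iterate_weightedTransfer_le hC0 hw hB0 hB n x
  obtain ⟨R, hRl⟩ := exists_weightedTransfer_linearMap (S.branch rep) (S.branchWeight rep u m)
  have hces : ∀ k (h : ∀ y, E y →L[ℂ] E y), pullEnd u (cesaroMean (S.transferOp m rep) k h) =
      cesaroMean R k (pullEnd u h) := by
    intro k h
    rw [S.pullEnd_cesaroMean_transferOp hrep, hRl]
  let T' : bundleEnd d E →ₗ[ℂ] bundleEnd d E :=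
    { toFun := T
      map_add' := fun h h' => huniq _ _ fun x => by
        simp only [Submodule.coe_add, pullEnd_add, hces, cesaroMean_add, Pi.add_apply]
        simp only [← hces]
        exact ((hTlim h).tendsto_at x).add ((hTlim h').tendsto_at x)
      map_smul' := fun c h => huniq _ _ fun x => by
        simp only [Submodule.coe_smul, pullEnd_smul, hces, cesaroMean_smul, Pi.smul_apply]
        simp only [← hces]
        exact ((hTlim h).tendsto_at x).const_smul c }
  refine ⟨T', fun g => ?_, fun n M hM => ?_, ?_, ?_, ?_, ?_⟩
  · rw [ENNReal.tendsto_nhds_zero]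
    intro ε hε
    obtain ⟨ε', hε', hεε⟩ : ∃ ε' : ℝ, 0 < ε' ∧ ENNReal.ofReal ε' ≤ ε := by
      obtain ⟨r, hr0, hr⟩ := ENNReal.lt_iff_exists_nnreal_btwn.mp hε
      exact ⟨r, by exact_mod_cast hr0, by simpa using hr.le⟩
    filter_upwards [Metric.tendstoUniformly_iff.mp (hTlim g) ε' hε'] with k hk
    refine (supNorm_le u fun x => ?_).trans hεε
    have h2 : pullEnd u (cesaroMean (S.transferOp m rep) k (g : ∀ y, E y →L[ℂ] E y) -
        (T g : ∀ y, E y →L[ℂ] E y)) x =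
        pullEnd u (cesaroMean (S.transferOp m rep) k (g : ∀ y, E y →L[ℂ] E y)) x -
          pullEnd u (T g : ∀ y, E y →L[ℂ] E y) x := by
      ext v : 1
      simp [pullEnd_apply]
    change ‖pullEnd u (cesaroMean (S.transferOp m rep) k (g : ∀ y, E y →L[ℂ] E y) -
        (T g : ∀ y, E y →L[ℂ] E y)) x‖ ≤ ε'
    rw [h2, ← dist_eq_norm, dist_comm]
    exact (hk x).le
  · exact S.sum_inner_nonneg_of_tendsto_cesaroMean hrep hM
      fun i j x => (hTlim (M i j)).tendsto_at x
  · ext1 g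
    exact hfixT (T g) (hTfix g)
  · -- the sup-norm is dominated by the norm of `L`, and dominates both norms on fixed points
    set C₁ := 1 + 2 * (Λ + 1 / (δ / 2)) with hC₁
    have hC₁0 : 0 < C₁ := by positivity
    refine ⟨Real.toNNReal ((1 + D) * C * C₁), fun g hg => ⟨hmemL _ (T g).2 (hTfix g), ?_⟩⟩
    set N := (lipOpNorm u (g : ∀ y, E y →L[ℂ] E y)).toReal with hN
    have hN0 : 0 ≤ N := ENNReal.toReal_nonneg
    have hNeq : ENNReal.ofReal N = lipOpNorm u (g : ∀ y, E y →L[ℂ] E y) :=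
      ENNReal.ofReal_toReal hg.2.2.ne
    have hsec := exists_lipSection_eq hp hφ hu hΛ0 hΛ (half_pos hδ)
      (fun x g h => hinj x g (by linarith))
    have hgN := hTnorm g (C₁ * N) (by positivity)
      (norm_pullEnd_le_of_lipOpNorm_le hC₁0 hN0 hsec hNeq.ge)
    refine (lipOpNorm_le (by positivity) (by positivity) hgN
      (hlip _ (T g).2 (hTfix g) _ (by positivity) hgN)).trans ?_
    rw [← hNeq]
    change _ ≤ ENNReal.ofReal _ * _
    rw [← ENNReal.ofReal_mul (by positivity)]
    exact ENNReal.ofReal_le_ofReal (le_of_eq (by ring))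
  · ext g
    constructor
    · rintro ⟨f, rfl⟩
      exact ⟨(T f).2, hTfix f⟩
    · rintro ⟨hg, hfix⟩
      exact ⟨⟨g, hg⟩, congrArg Subtype.val (hfixT ⟨g, hg⟩ hfix)⟩
  · ext g
    constructor
    · rintro ⟨hg, hfix⟩
      exact ⟨hmemL g hg hfix, hfix⟩
    · rintro ⟨hg, hfix⟩
      exact ⟨hg.1, hfix⟩
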